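/- **Setting.** Let $\mathcal F=(\mathcal F_n)_{n\ge 0}$ be a collection of functions such that every $g\in\mathcal F_n$ is real analytic on a neighbourhood of $[-1,1]^n$ (for example, a Weierstrass system), let $K\subseteq\mathbb R$ be a subfield, and let $\mathbb R_{\mathcal F}^K$ be the ordered field $\mathbb R$ expanded by the functions equal to $g$ on $[-1,1]^n$ and to $0$ elsewhere ($g\in\mathcal F_n$), and by the power maps equal to $x^s$ for $x>0$ and to $0$ for $x\le 0$ ($s\in K$). "Definable" means definable in this structure with real parameters. A *cell* in $\mathbb R^n$ is a set given, for $i=1,\dots,n$ successively, by a condition $z_i=\alpha_i(z_{<i})$, or $\alpha_i(z_{<i})<z_i<\beta_i(z_{<i})$ where either inequality may be absent, with $z_{<i}=(z_1,\dots,z_{i-1})$ and $\alpha_i,\beta_i$ continuous and definable on the cell in $\mathbb R^{i-1}$ given by the preceding conditions, and $\alpha_i<\beta_i$ there. In a coordinate with a condition of the second kind, $\alpha_i,\beta_i$ are called the walls of $z_i$. For $C\subseteq\mathbb R^k\times\mathbb R^m$ let $\pi(C)\subseteq\mathbb R^k$ be its projection, $C_t=\{x:(t,x)\in C\}$, and $f_t(x)=f(t,x)$.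 If $C$ is a cell in $\mathbb R^k\times(0,1)^m$, a bounded definable $f:C\to\mathbb R$ is *prepared in $x$ with associated bounded monomial map* $b=(b_1,\dots,b_N):C\to\mathbb R^N$ if $b$ is bounded, $b_i(t,x)=a_i(t)\prod_{l=1}^m x_l^{\mu_{i,l}}$ with $a_i:\pi(C)\to\mathbb R$ definable and $\mu_{i,l}\in K$, and $f=b_j\cdot(G\circ b)$ for some $j$ and some function $G$ that is analytic and non-vanishing on an open neighbourhood of $\overline{b(C)}$. The map $b$ is *$C^1$-bounded in $x$* if there is a constant $B$ such that, for all $t\in\pi(C)$, every component of $b_t$ is $C^1$ on $C_t$ and it and its first order partial derivatives are bounded by $B$ in absolute value. For $A>0$ and $r\in\{1,2,\dots\}\cup\{\infty\}$, a function $g:U\to\mathbb R$ on an open set $U\subseteq\mathbb R^d$ is *$(A,0)$-mild up to order $r$* if it is $C^r$ and $|g^{(\nu)}(x)|\le A^{|\nu|}\,|\nu|!$ for all $x\in U$ and all $\nu\in\mathbb N^d$ with $|\nu|\le r$; it is *$(A,0)$-mild* if this holds with $r=\infty$. **Proposition.** Let $T\subseteq\mathbb R^k$ be definable, let $C\subseteq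 T\times(0,1)^m$ be a cell in $\mathbb R^k\times\mathbb R^m$ whose fibers $C_t$ are open, and let $f:C\to[-1,1]$. Suppose that $f$ is prepared in $x$ with an associated bounded monomial map that is $C^1$-bounded in $x$, and that for each $i=1,\dots,m$ each of the two walls of $x_i$, as a function of $(t,x_{<i})$ on the image of $C$ under $(t,x)\mapsto(t,x_{<i})$, is also prepared in $x$ with an associated bounded monomial map that is $C^1$-bounded in $x$. For an integer $r>0$ define $\phi_r:T\times(0,1)^m\to T\times(0,1)^m$ by $$\phi_r(t,x)=(t,x_1^{r^m},x_2^{r^{m-1}},\dots,x_m^{r})$$ and set $C_r=\phi_r^{-1}(C)$. Then there exists $A>0$, independent of $r$ and $t$, such that for every integer $r>0$ the set $C_r$ is a cell with open fibers over $\mathbb R^k$, and for every $t\in T$: 1. the walls of $x_1$ of $C_{r,t}$ are $(A,0)$-mild; 2. for $i=2,\dots,m$, the walls of $x_i$ of $C_{r,t}$ are $(r^mA,0)$-mild up to order $r$; 3. $(f\circ\phi_r)_t:C_{r,t}\to[-1,1]$ is $(r^mA,0)$-mild up to order $r$. -/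

import Mathlib

open scoped ENNReal NNReal

/-! ### Mild functions -/

namespace MildCell

/-- `f^(ν)(x) = ∂^|ν| f / ∂x₁^{ν₁} ⋯ ∂x_d^{ν_d} (x)`: the `|ν|`-th derivative of `f` at `x`, evaluated
at the tuple of basis vectors that contains `e_i` exactly `ν_i` times. It is used at points of
open sets on which `f` is `|ν|` times continuously differentiable. -/
noncomputable def mpartial {d : ℕ} (ν : Fin d → ℕ) (f : (Fin d → ℝ) → ℝ) (x : Fin d → ℝ) : ℝ :=
  iteratedFDeriv ℝ (∑ i, ν i) f x
    (fun j => Pi.single (finSigmaFinEquiv.symm j : (i : Fin d) × Fin (ν i)).1 1)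

/-- `f` is `(A,B,C)`-mild up to order `r` on `U`; `r = ⊤` gives `(A,B,C)`-mild functions. -/
def MildUpToABC {d : ℕ} (A B C : ℝ) (r : ℕ∞) (U : Set (Fin d → ℝ)) (f : (Fin d → ℝ) → ℝ) :
    Prop :=
  ContDiffOn ℝ r f U ∧
    ∀ ν : Fin d → ℕ, ((∑ i, ν i : ℕ) : ℕ∞) ≤ r → ∀ x ∈ U,
      |mpartial ν f x| ≤
        B ^ (C + 1) * A ^ (∑ i, ν i) * ((∑ i, ν i).factorial : ℝ) ^ (C + 1)

/-- `f` is `(A,C)`-mild up to order `r` on `U`. -/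
def MildUpTo {d : ℕ} (A C : ℝ) (r : ℕ∞) (U : Set (Fin d → ℝ)) (f : (Fin d → ℝ) → ℝ) : Prop :=
  ∃ B : ℝ, 0 < B ∧ B ≤ 1 ∧ MildUpToABC A B C r U f

/-- `f` is `(A,C)`-mild on `U`. -/
def Mild {d : ℕ} (A C : ℝ) (U : Set (Fin d → ℝ)) (f : (Fin d → ℝ) → ℝ) : Prop :=
  MildUpTo A C ⊤ U f

/-- The `C^r`-norm, with values in `[0,∞]`, of a map `f : U → ℝ^N`: the supremum over `x ∈ U`, over
`|ν| ≤ r` and over the components `f_n` of `|f_n^(ν)(x)| / |ν|!`. -/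
noncomputable def crNorm {d N : ℕ} (r : ℕ) (U : Set (Fin d → ℝ))
    (f : (Fin d → ℝ) → (Fin N → ℝ)) : ℝ≥0∞ :=
  ⨆ (n : Fin N) (x ∈ U) (ν : Fin d → ℕ) (_ : ∑ i, ν i ≤ r),
    ENNReal.ofReal (|mpartial ν (fun y => f y n) x| / ((∑ i, ν i).factorial : ℝ))

/-! ### The structure `ℝ_F^K` and definability -/

/-- Function symbols: those of ordered rings, one `n`-ary symbol for every function in `F n`, and
one unary symbol for every exponent in `K`. -/
inductive PowFunc (F : (n : ℕ) → Set ((Fin n → ℝ) → ℝ)) (K : Subfield ℝ) : ℕ → Type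
  | add : PowFunc F K 2
  | sub : PowFunc F K 2
  | mul : PowFunc F K 2
  | zero : PowFunc F K 0
  | one : PowFunc F K 0
  | restr {n : ℕ} (f : F n) : PowFunc F K n
  | power (s : K) : PowFunc F K 1

/-- The only relation symbol is the binary symbol `<`. -/
inductive PowRel : ℕ → Type
  | lt : PowRel 2

/-- The language `L_F^K`. -/
def powLang (F : (n : ℕ) → Set ((Fin n → ℝ) → ℝ)) (K : Subfield ℝ) : FirstOrder.Language where
  Functions := PowFunc F K
  Relations := PowRel

open Classical in
/-- The structure `ℝ_F^K`: `f ∈ F n` is interpreted as `f` on `[-1,1]^n` and `0` elsewhere, and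
`s ∈ K` as `x ↦ x^s` for `x > 0` and `0` for `x ≤ 0`. -/
noncomputable instance powStructure (F : (n : ℕ) → Set ((Fin n → ℝ) → ℝ)) (K : Subfield ℝ) :
    (powLang F K).Structure ℝ where
  funMap {_} s v :=
    match s, v with
    | PowFunc.add, v => v 0 + v 1
    | PowFunc.sub, v => v 0 - v 1
    | PowFunc.mul, v => v 0 * v 1
    | PowFunc.zero, _ => 0
    | PowFunc.one, _ => 1
    | PowFunc.restr f, v => if ∀ i, v i ∈ Set.Icc (-1 : ℝ) 1 then f.1 v else 0
    | PowFunc.power s, v => if 0 < v 0 then (v 0) ^ (s : ℝ) else 0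
  RelMap {_} s v :=
    match s, v with
    | PowRel.lt, v => v 0 < v 1

section Definable

variable (F : (n : ℕ) → Set ((Fin n → ℝ) → ℝ)) (K : Subfield ℝ)

/-- Definability in `ℝ_F^K`, with real parameters. -/
def IsDefinable {n : ℕ} (S : Set (Fin n → ℝ)) : Prop :=
  (Set.univ : Set ℝ).Definable (powLang F K) S

/-- The function `f : D → ℝ` is definable, that is, its graph in `ℝ^(n+1)` is. -/
def IsDefinableFun {n : ℕ} (D : Set (Fin n → ℝ)) (f : (Fin n → ℝ) → ℝ) : Prop :=
  IsDefinable F K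
    {p : Fin (n + 1) → ℝ | Fin.init p ∈ D ∧ p (Fin.last n) = f (Fin.init p)}

/-! ### Cells -/

/-- The condition that a cell puts on a coordinate `z` in terms of the `n` preceding ones `y`. -/
inductive CoordCond (n : ℕ) : Type
  /-- `z = α y` -/
  | graph (α : (Fin n → ℝ) → ℝ) : CoordCond n
  /-- no condition -/
  | free : CoordCond n
  /-- `α y < z` -/
  | above (α : (Fin n → ℝ) → ℝ) : CoordCond n
  /-- `z < β y` -/
  | below (β : (Fin n → ℝ) → ℝ) : CoordCond n
  /-- `α y < z < β y` -/
  | between (α β : (Fin n → ℝ) → ℝ) : CoordCond n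

/-- `z` satisfies the condition, given the preceding coordinates `y`. -/
def CoordCond.Holds {n : ℕ} (c : CoordCond n) (y : Fin n → ℝ) (z : ℝ) : Prop :=
  match c with
  | .graph α => z = α y
  | .free => True
  | .above α => α y < z
  | .below β => z < β y
  | .between α β => α y < z ∧ z < β y

/-- The functions in the condition are continuous and definable on `D`, and `α < β` on `D`. -/
def CoordCond.Admissible {n : ℕ} (c : CoordCond n) (D : Set (Fin n → ℝ)) : Prop :=
  match c with
  | .graph α => ContinuousOn α D ∧ IsDefinableFun F K D α
  | .free => True
  | .above α => ContinuousOn α D ∧ IsDefinableFun F K D α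
  | .below β => ContinuousOn β D ∧ IsDefinableFun F K D β
  | .between α β =>
      (ContinuousOn α D ∧ IsDefinableFun F K D α) ∧
      (ContinuousOn β D ∧ IsDefinableFun F K D β) ∧ ∀ y ∈ D, α y < β y

/-- The set of all `y ∈ ℝ^j`, `j ≤ n`, that satisfy the first `j` of the conditions `c`. -/
def cellSet {n : ℕ} (c : (i : Fin n) → CoordCond (i : ℕ)) (j : ℕ) (hj : j ≤ n) :
    Set (Fin j → ℝ) :=
  {y | ∀ i : Fin j, (c (Fin.castLE hj i)).Holds (Fin.take (i : ℕ) i.2.le y) (y i)}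

/-- `C` is the cell in `ℝ^n` that is described by the conditions `c`. -/
def IsCellWith {n : ℕ} (C : Set (Fin n → ℝ)) (c : (i : Fin n) → CoordCond (i : ℕ)) : Prop :=
  (∀ i : Fin n, (c i).Admissible F K (cellSet c (i : ℕ) i.2.le)) ∧ C = cellSet c n le_rfl

/-- `C` is a cell in `ℝ^k × ℝ^m` whose fibers over `ℝ^k` are open and bounded, with walls
`α_i < β_i` of `x_i`; the index `i = 0` belongs to `x_1`, and `α_i, β_i` are functions of
`(t, x_{<i})`. -/
def IsCellWithWalls {k m : ℕ} (C : Set (Fin (k + m) → ℝ))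
    (α β : (i : Fin m) → (Fin (k + (i : ℕ)) → ℝ) → ℝ) : Prop :=
  ∃ c : (i : Fin (k + m)) → CoordCond (i : ℕ),
    IsCellWith F K C c ∧
      ∀ i : Fin m, c (Fin.natAdd k i) = CoordCond.between (α i) (β i)

/-! ### Families over the parameter space `ℝ^k`

A point `(t,x)` of `ℝ^k × ℝ^m` is a function on `Fin (k + m)`. -/

/-- The component `t` of `(t,x)`. -/
def tPart {k m : ℕ} (p : Fin (k + m) → ℝ) : Fin k → ℝ := fun i => p (Fin.castAdd m i)

/-- The component `x` of `(t,x)`. -/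
def xPart {k m : ℕ} (p : Fin (k + m) → ℝ) : Fin m → ℝ := fun i => p (Fin.natAdd k i)

/-- The fiber `C_t`. -/
def fiber {k m : ℕ} (C : Set (Fin (k + m) → ℝ)) (t : Fin k → ℝ) : Set (Fin m → ℝ) :=
  {x | Fin.append t x ∈ C}

/-- The function `f_t : x ↦ f(t,x)`. -/
def fiberFun {k m : ℕ} {E : Type*} (f : (Fin (k + m) → ℝ) → E) (t : Fin k → ℝ) :
    (Fin m → ℝ) → E :=
  fun x => f (Fin.append t x)

/-- The image of `C ⊆ ℝ^k × ℝ^m` under `(t,x) ↦ (t,x_{<i})`; the index `i = 0` belongs to `x_1`. -/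
def projLt {k m : ℕ} (i : Fin m) (C : Set (Fin (k + m) → ℝ)) : Set (Fin (k + (i : ℕ)) → ℝ) :=
  Fin.take (k + (i : ℕ)) (Nat.add_le_add_left i.2.le k) '' C

/-- The family `f : C → ℝ^N` is `C^r`-bounded in `x`. -/
def IsCrBoundedInX {k m N : ℕ} (r : ℕ) (C : Set (Fin (k + m) → ℝ))
    (f : (Fin (k + m) → ℝ) → (Fin N → ℝ)) : Prop :=
  ∃ B : ℝ≥0, ∀ t ∈ tPart '' C,
    ContDiffOn ℝ r (fiberFun f t) (fiber C t) ∧ crNorm r (fiber C t) (fiberFun f t) ≤ B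

/-- The function `f : C → ℝ` is prepared in `x` with associated bounded monomial map `b`. -/
structure IsPreparedInX {k m N : ℕ} (C : Set (Fin (k + m) → ℝ)) (f : (Fin (k + m) → ℝ) → ℝ)
    (b : (Fin (k + m) → ℝ) → (Fin N → ℝ)) : Prop where
  bounded : ∃ M : ℝ, ∀ p ∈ C, |f p| ≤ M
  definable : IsDefinableFun F K C f
  bounded_map : Bornology.IsBounded (b '' C)
  monomial : ∀ i : Fin N, ∃ (a : (Fin k → ℝ) → ℝ) (μ : Fin m → K),
    IsDefinableFun F K (tPart '' C) a ∧
      ∀ p ∈ C, b p i = a (tPart p) * ∏ l, xPart p l ^ (μ l : ℝ)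
  factor : ∃ (j : Fin N) (G : (Fin N → ℝ) → ℝ) (V : Set (Fin N → ℝ)),
    IsOpen V ∧ closure (b '' C) ⊆ V ∧ AnalyticOnNhd ℝ G V ∧ (∀ z ∈ V, G z ≠ 0) ∧
      ∀ p ∈ C, f p = b p j * G (b p)

/-- `f : C → ℝ` is prepared in `x` with an associated bounded monomial map that is `C^1`-bounded
in `x`. -/
def IsC1PreparedInX {k m : ℕ} (C : Set (Fin (k + m) → ℝ)) (f : (Fin (k + m) → ℝ) → ℝ) : Prop :=
  ∃ (N : ℕ) (b : (Fin (k + m) → ℝ) → (Fin N → ℝ)),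
    IsPreparedInX F K C f b ∧ IsCrBoundedInX 1 C b

end Definable

/-- The set `T × (0,1)^m`. -/
def cubeOver {k : ℕ} (T : Set (Fin k → ℝ)) (m : ℕ) : Set (Fin (k + m) → ℝ) :=
  {p | tPart p ∈ T ∧ ∀ i, xPart p i ∈ Set.Ioo (0 : ℝ) 1}

/-- `φ_r(t,x) = (t, x_1^{r^m}, x_2^{r^{m-1}}, …, x_m^r)`; the index `i = 0` belongs to `x_1`. -/
def powSub {k m : ℕ} (r : ℕ) (p : Fin (k + m) → ℝ) : Fin (k + m) → ℝ :=
  Fin.append (tPart p) (fun i : Fin m => xPart p i ^ r ^ (m - (i : ℕ)))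

/-- `C_r = φ_r⁻¹(C)`, for `φ_r` as a map from `T × (0,1)^m` to itself. -/
def pullback {k m : ℕ} (T : Set (Fin k → ℝ)) (r : ℕ) (C : Set (Fin (k + m) → ℝ)) :
    Set (Fin (k + m) → ℝ) :=
  {p | p ∈ cubeOver T m ∧ powSub r p ∈ C}

end MildCell

namespace MildCell

/-! ### Counting ordered partitions -/

lemma sum_descFactorial_length (X n : ℕ) :
    ∑ c : OrderedFinpartition n, X.descFactorial c.length = X ^ n := by
  induction n with
  | zero =>
    have h : ∀ c : OrderedFinpartition 0, c.length = 0 := fun c => Nat.le_zero.1 c.length_le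
    simp only [h, Nat.descFactorial_zero]
    simp
  | succ n ih =>
    rw [← (OrderedFinpartition.extendEquiv n).sum_comp, Fintype.sum_sigma, pow_succ, ← ih,
      Finset.sum_mul]
    refine Finset.sum_congr rfl fun c _ => ?_
    rw [Fintype.sum_option]
    simp only [OrderedFinpartition.extendEquiv_apply, OrderedFinpartition.extend_none,
      OrderedFinpartition.extend_some, OrderedFinpartition.extendLeft_length,
      OrderedFinpartition.extendMiddle_length, Finset.sum_const, Finset.card_univ,
      Fintype.card_fin, smul_eq_mul, Nat.descFactorial_succ]
    rcases le_or_gt c.length X with h | h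
    · rw [← add_mul, Nat.sub_add_cancel h, mul_comm]
    · simp [Nat.descFactorial_of_lt h]

lemma sum_factorial_length_le (n : ℕ) :
    (∑ c : OrderedFinpartition n, (c.length.factorial : ℝ)) ≤ Real.exp 1 ^ n * n.factorial := by
  have h1 : ∑ c : OrderedFinpartition n, c.length.factorial ≤ n ^ n := by
    rw [← sum_descFactorial_length]
    refine Finset.sum_le_sum fun c _ => ?_
    rw [Nat.descFactorial_eq_factorial_mul_choose]
    exact Nat.le_mul_of_pos_right _ (Nat.choose_pos c.length_le)
  have h2 := Real.pow_div_factorial_le_exp (x := n) (Nat.cast_nonneg n) n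
  rw [div_le_iff₀ (by positivity)] at h2
  calc (∑ c : OrderedFinpartition n, (c.length.factorial : ℝ)) ≤ (n : ℝ) ^ n := by exact_mod_cast h1
    _ ≤ _ := h2
    _ = _ := by rw [← Real.exp_nat_mul, mul_one]

/-! ### Derivatives of analytic functions on compact sets -/

section Analytic

variable {E : Type*} [NormedAddCommGroup E] [NormedSpace ℝ E]

lemma norm_iteratedFDeriv_le_of_hasFPowerSeriesOnBall {g : E → ℝ}
    {p : FormalMultilinearSeries ℝ E ℝ} {x : E} {ρ : ℝ≥0∞}
    (h : HasFPowerSeriesOnBall g p x ρ) (n : ℕ) :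
    ‖iteratedFDeriv ℝ n g x‖ ≤ n.factorial * ‖p n‖ := by
  refine ContinuousMultilinearMap.opNorm_le_bound (by positivity) fun v => ?_
  rw [h.iteratedFDeriv_eq_sum_of_completeSpace v]
  refine (norm_sum_le _ _).trans ?_
  have : ∀ σ : Equiv.Perm (Fin n), ‖p n (fun i => v (σ i))‖ ≤ ‖p n‖ * ∏ i, ‖v i‖ := fun σ => by
    refine ((p n).le_opNorm _).trans_eq ?_
    rw [Equiv.prod_comp σ fun i => ‖v i‖]
  refine (Finset.sum_le_sum fun σ _ => this σ).trans_eq ?_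
  simp [Fintype.card_perm, mul_assoc]

lemma norm_changeOrigin_le_of_lt_radius (p : FormalMultilinearSeries ℝ E ℝ) {s s' : ℝ≥0}
    (hs' : 0 < s') (hr : (s + s' : ℝ≥0∞) < p.radius) :
    ∃ M : ℝ, ∀ y : E, ‖y‖ ≤ s → ∀ n, ‖p.changeOrigin y n‖ ≤ M * (s' : ℝ)⁻¹ ^ n := by
  have hsum := p.changeOriginSeries_summable_aux₁ hr
  refine ⟨(∑' a : Σ k l : ℕ, { s : Finset (Fin (k + l)) // s.card = l },
      ‖p (a.1 + a.2.1)‖₊ * s ^ a.2.1 * s' ^ a.1 : ℝ≥0), fun y hy n => ?_⟩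
  have hy' : ‖y‖₊ ≤ s := hy
  have hyr : (‖y‖₊ : ℝ≥0∞) < p.radius :=
    lt_of_le_of_lt ((ENNReal.coe_le_coe.2 hy').trans le_self_add) hr
  have h1 := p.nnnorm_changeOrigin_le n hyr
  have hn := (NNReal.summable_sigma.1 hsum).1 n
  have hle : ∀ a : Σ l : ℕ, { s : Finset (Fin (n + l)) // s.card = l },
      ‖p (n + a.1)‖₊ * ‖y‖₊ ^ a.1 * s' ^ n ≤ ‖p (n + a.1)‖₊ * s ^ a.1 * s' ^ n :=
    fun a => by gcongr
  have h2 : (∑' a : Σ l : ℕ, { s : Finset (Fin (n + l)) // s.card = l },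
      ‖p (n + a.1)‖₊ * ‖y‖₊ ^ a.1) * s' ^ n ≤
      ∑' a : Σ k l : ℕ, { s : Finset (Fin (k + l)) // s.card = l },
        ‖p (a.1 + a.2.1)‖₊ * s ^ a.2.1 * s' ^ a.1 := by
    rw [← NNReal.tsum_mul_right]
    refine le_trans ?_ (NNReal.tsum_comp_le_tsum_of_inj hsum (sigma_mk_injective (i := n)))
    exact Summable.tsum_le_tsum hle (NNReal.summable_of_le hle hn) hn
  have h3 : ‖p.changeOrigin y n‖₊ * s' ^ n ≤ _ := (mul_le_mul_left h1 (s' ^ n)).trans h2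
  rw [inv_pow, ← div_eq_mul_inv, le_div_iff₀ (by positivity)]
  exact_mod_cast h3

lemma exists_norm_iteratedFDeriv_le_of_analyticAt {g : E → ℝ} {z : E} (h : AnalyticAt ℝ g z) :
    ∃ A : ℝ, ∃ V ∈ nhds z, ∀ y ∈ V, ∀ n,
      ‖iteratedFDeriv ℝ n g y‖ ≤ A ^ (n + 1) * n.factorial := by
  obtain ⟨p, ρ, hp⟩ := h
  obtain ⟨ε, hε0, hε⟩ := ENNReal.lt_iff_exists_nnreal_btwn.1 hp.r_pos
  have hε0' : 0 < ε := by exact_mod_cast hε0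
  have hsum : ((ε / 2 : ℝ≥0) + (ε / 2 : ℝ≥0) : ℝ≥0∞) < p.radius := by
    rw [← ENNReal.coe_add, add_halves]
    exact hε.trans_le hp.r_le
  obtain ⟨M, hM⟩ := norm_changeOrigin_le_of_lt_radius p (half_pos hε0') hsum
  refine ⟨max 1 (max M ((ε / 2 : ℝ≥0) : ℝ)⁻¹), Metric.closedBall z (ε / 2 : ℝ≥0),
    Metric.closedBall_mem_nhds _ (by exact_mod_cast half_pos hε0'), fun y hy n => ?_⟩
  rw [Metric.mem_closedBall, dist_eq_norm] at hy
  have hlt : (‖y - z‖₊ : ℝ≥0∞) < ρ := by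
    refine lt_of_le_of_lt (ENNReal.coe_le_coe.2 (show ‖y - z‖₊ ≤ ε / 2 from hy)) ?_
    refine lt_of_le_of_lt (ENNReal.coe_le_coe.2 (half_le_self (zero_le))) hε
  have hy' := hp.changeOrigin hlt
  rw [add_sub_cancel] at hy'
  refine (norm_iteratedFDeriv_le_of_hasFPowerSeriesOnBall hy' n).trans ?_
  rw [mul_comm]
  gcongr
  refine (hM _ hy n).trans ?_
  rw [pow_succ']
  gcongr
  · exact (le_max_left _ _).trans (le_max_right _ _)
  · exact (le_max_right _ _).trans (le_max_right _ _)

lemma exists_norm_iteratedFDeriv_le_of_isCompact {g : E → ℝ} {Z : Set E} (hZ : IsCompact Z)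
    (h : AnalyticOnNhd ℝ g Z) :
    ∃ A : ℝ, 1 ≤ A ∧ ∀ y ∈ Z, ∀ n, ‖iteratedFDeriv ℝ n g y‖ ≤ A ^ (n + 1) * n.factorial := by
  refine hZ.induction_on (p := fun S => ∃ A : ℝ, 1 ≤ A ∧ ∀ y ∈ S, ∀ n,
    ‖iteratedFDeriv ℝ n g y‖ ≤ A ^ (n + 1) * n.factorial) ⟨1, le_rfl, by simp⟩
    (fun S S' hS ⟨A, hA, h⟩ => ⟨A, hA, fun y hy => h y (hS hy)⟩) ?_ ?_
  · rintro S S' ⟨A, hA, h⟩ ⟨A', hA', h'⟩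
    refine ⟨max A A', hA.trans (le_max_left _ _), fun y hy n => ?_⟩
    rcases hy with hy | hy
    · refine (h y hy n).trans ?_
      gcongr
      exact le_max_left _ _
    · refine (h' y hy n).trans ?_
      gcongr
      exact le_max_right _ _
  · intro z hz
    obtain ⟨A, V, hV, hA⟩ := exists_norm_iteratedFDeriv_le_of_analyticAt (h z hz)
    refine ⟨V, mem_nhdsWithin_of_mem_nhds hV, max 1 |A|, le_max_left _ _, fun y hy n => ?_⟩
    refine (hA y hy n).trans ?_
    refine mul_le_mul_of_nonneg_right ?_ (by positivity)
    refine (le_abs_self _).trans ?_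
    rw [abs_pow]
    gcongr
    exact le_max_right _ _

end Analytic

/-! ### Functions with geometrically bounded derivatives -/

section GeomBound

variable {E : Type*} [NormedAddCommGroup E] [NormedSpace ℝ E]
variable {G G' : Type*} [NormedAddCommGroup G] [NormedSpace ℝ G]
  [NormedAddCommGroup G'] [NormedSpace ℝ G']

/-- On `U` the function `u` is `C^r`, and its derivatives of order `n`, `1 ≤ n ≤ r`, are bounded by
`P * L ^ n`. -/
def GeomBound (P L : ℝ) (r : ℕ) (U : Set E) (u : E → G) : Prop :=
  ContDiffOn ℝ r u U ∧ ∀ n, 1 ≤ n → n ≤ r → ∀ x ∈ U, ‖iteratedFDerivWithin ℝ n u U x‖ ≤ P * L ^ n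

lemma GeomBound.congr {P L : ℝ} {r : ℕ} {U : Set E} {u v : E → G} (h : GeomBound P L r U u)
    (huv : Set.EqOn v u U) : GeomBound P L r U v :=
  ⟨h.1.congr huv, fun n h1 hn x hx => by
    rw [iteratedFDerivWithin_congr huv hx]; exact h.2 n h1 hn x hx⟩

lemma geomBound_const {P L : ℝ} (hP : 0 ≤ P) (hL : 0 ≤ L) (r : ℕ) (U : Set E) (c : G) :
    GeomBound P L r U (fun _ => c) := by
  refine ⟨contDiffOn_const, fun n h1 _ x _ => ?_⟩
  rw [iteratedFDerivWithin_const_of_ne (by lia)]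
  simp only [Pi.zero_apply, norm_zero]
  positivity

lemma GeomBound.prodMk {P L : ℝ} {r : ℕ} {U : Set E} (hU : UniqueDiffOn ℝ U) {u : E → G}
    {v : E → G'} (hu : GeomBound P L r U u) (hv : GeomBound P L r U v) :
    GeomBound P L r U (fun x => (u x, v x)) := by
  refine ⟨hu.1.prodMk hv.1, fun n h1 hn x hx => ?_⟩
  have h := ((hu.1.ftaylorSeriesWithin hU).prodMk
    (hv.1.ftaylorSeriesWithin hU)).eq_iteratedFDerivWithin_of_uniqueDiffOn
      (m := n) (by exact_mod_cast hn) hU hx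
  rw [← h, ContinuousMultilinearMap.opNorm_prod]
  exact max_le (hu.2 n h1 hn x hx) (hv.2 n h1 hn x hx)

lemma GeomBound.pi {ι : Type*} [Fintype ι] {P L : ℝ} (hP : 0 ≤ P) (hL : 0 ≤ L) {r : ℕ} {U : Set E}
    (hU : UniqueDiffOn ℝ U) {u : E → ι → ℝ} (hu : ∀ i, GeomBound P L r U (fun x => u x i)) :
    GeomBound P L r U u := by
  refine ⟨contDiffOn_pi.2 fun i => (hu i).1, fun n h1 hn x hx => ?_⟩
  have h := (hasFTaylorSeriesUpToOn_pi.2 fun i => (hu i).1.ftaylorSeriesWithin hU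
    ).eq_iteratedFDerivWithin_of_uniqueDiffOn (m := n) (by exact_mod_cast hn) hU hx
  change _ = iteratedFDerivWithin ℝ n u U x at h
  rw [← h, ContinuousMultilinearMap.opNorm_pi]
  exact (pi_norm_le_iff_of_nonneg (by positivity)).2 fun i => (hu i).2 n h1 hn x hx

/-- A real analytic function on a compact set, composed with functions whose derivatives are
geometrically bounded, has derivatives of the growth that mildness asks for. -/
lemma exists_norm_iteratedFDerivWithin_comp_le {g : G → ℝ} {Z : Set G} (hZ : IsCompact Z)
    (h : AnalyticOnNhd ℝ g Z) :
    ∃ A : ℝ, 1 ≤ A ∧ ∀ {E : Type} [NormedAddCommGroup E] [NormedSpace ℝ E]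
      (P L : ℝ) (r : ℕ) (U : Set E) (u : E → G), 1 ≤ P → 0 ≤ L → UniqueDiffOn ℝ U →
      GeomBound P L r U u → Set.MapsTo u U Z →
      ContDiffOn ℝ r (g ∘ u) U ∧ ∀ n, 1 ≤ n → n ≤ r → ∀ x ∈ U,
        ‖iteratedFDerivWithin ℝ n (g ∘ u) U x‖ ≤ (A * P * L) ^ n * n.factorial := by
  obtain ⟨A, hA1, hA⟩ := exists_norm_iteratedFDeriv_le_of_isCompact hZ h
  refine ⟨A * A * Real.exp 1, ?_, fun {E} _ _ P L r U u hP hL hU hu hmap => ?_⟩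
  · have := Real.one_le_exp (zero_le_one (α := ℝ))
    nlinarith [mul_le_mul hA1 hA1 zero_le_one (by linarith)]
  set V : Set G := {z | AnalyticAt ℝ g z} with hV
  have hVo : IsOpen V := isOpen_analyticAt ℝ g
  have hgV : ContDiffOn ℝ r g V := fun z hz => (AnalyticAt.contDiffAt hz).contDiffWithinAt
  have hmapV : Set.MapsTo u U V := fun x hx => h _ (hmap hx)
  refine ⟨hgV.comp hu.1 hmapV, fun n h1 hn x hx => ?_⟩
  have hcomp := ((hgV.ftaylorSeriesWithin hVo.uniqueDiffOn).comp
    (hu.1.ftaylorSeriesWithin hU) hmapV).eq_iteratedFDerivWithin_of_uniqueDiffOn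
      (m := n) (by exact_mod_cast hn) hU hx
  rw [← hcomp]
  refine (norm_sum_le _ _).trans ?_
  have hterm : ∀ c : OrderedFinpartition n,
      ‖(ftaylorSeriesWithin ℝ g V (u x)).compAlongOrderedFinpartition
        (ftaylorSeriesWithin ℝ u U x) c‖ ≤ A ^ (n + 1) * P ^ n * L ^ n * c.length.factorial := by
    intro c
    refine (c.norm_compAlongOrderedFinpartition_le _ _).trans ?_
    have e1 : ‖ftaylorSeriesWithin ℝ g V (u x) c.length‖ ≤ A ^ (n + 1) * c.length.factorial := by
      change ‖iteratedFDerivWithin ℝ c.length g V (u x)‖ ≤ _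
      rw [iteratedFDerivWithin_of_isOpen _ hVo (hmapV hx)]
      refine (hA _ (hmap hx) _).trans ?_
      gcongr
      exact c.length_le
    have e2 : ∏ i, ‖ftaylorSeriesWithin ℝ u U x (c.partSize i)‖ ≤ P ^ n * L ^ n := by
      calc ∏ i, ‖ftaylorSeriesWithin ℝ u U x (c.partSize i)‖
          ≤ ∏ i, P * L ^ c.partSize i :=
            Finset.prod_le_prod (fun _ _ => norm_nonneg _) fun i _ =>
              hu.2 _ (c.partSize_pos i) ((c.partSize_le i).trans hn) x hx
        _ = P ^ c.length * L ^ n := by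
            rw [Finset.prod_mul_distrib, Finset.prod_const, Finset.prod_pow_eq_pow_sum]
            have : ∑ i, c.partSize i = n := by
              simpa using c.sum_sigma_eq_sum (fun _ => (1 : ℕ))
            simp [this]
        _ ≤ P ^ n * L ^ n := by
            gcongr
            exact c.length_le
    calc _ ≤ (A ^ (n + 1) * c.length.factorial) * (P ^ n * L ^ n) := by gcongr
      _ = _ := by ring
  refine (Finset.sum_le_sum fun c _ => hterm c).trans ?_
  rw [← Finset.mul_sum]
  calc A ^ (n + 1) * P ^ n * L ^ n * ∑ c : OrderedFinpartition n, (c.length.factorial : ℝ)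
      ≤ A ^ (n + n) * P ^ n * L ^ n * (Real.exp 1 ^ n * n.factorial) := by
        gcongr
        exact sum_factorial_length_le n
    _ = _ := by rw [pow_add]; simp only [mul_pow]; ring

end GeomBound

/-! ### Derivatives of monomials with real exponents -/

section Monomial

variable {d : ℕ}

lemma abs_descPochhammer_eval_le (c : ℝ) (n : ℕ) :
    |(descPochhammer ℝ n).eval c| ≤ (|c| + n) ^ n := by
  rw [descPochhammer_eval_eq_prod_range, Finset.abs_prod]
  calc ∏ j ∈ Finset.range n, |c - j| ≤ ∏ _j ∈ Finset.range n, (|c| + n) := by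
        refine Finset.prod_le_prod (fun _ _ => abs_nonneg _) fun j hj => ?_
        refine (abs_sub _ _).trans ?_
        rw [Nat.abs_cast]
        have : j ≤ n := (Finset.mem_range.1 hj).le
        gcongr
    _ = _ := by simp

lemma contDiffOn_coord_rpow {U : Set (Fin d → ℝ)} (hpos : ∀ x ∈ U, ∀ l, 0 < x l) (l : Fin d)
    (c : ℝ) {n : WithTop ℕ∞} : ContDiffOn ℝ n (fun x : Fin d → ℝ => x l ^ c) U := fun x hx =>
  ((Real.contDiffAt_rpow_const_of_ne (hpos x hx l).ne').comp x
    (contDiff_apply ℝ ℝ l).contDiffAt).contDiffWithinAt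

lemma norm_iteratedFDerivWithin_coord_rpow_le {U : Set (Fin d → ℝ)} (hU : IsOpen U)
    (hpos : ∀ x ∈ U, ∀ l, 0 < x l) (l : Fin d) (c : ℝ) (n : ℕ) {x : Fin d → ℝ} (hx : x ∈ U) :
    ‖iteratedFDerivWithin ℝ n (fun x : Fin d → ℝ => x l ^ c) U x‖ ≤
      |(descPochhammer ℝ n).eval c| * x l ^ (c - n) := by
  let g : (Fin d → ℝ) →L[ℝ] ℝ := ContinuousLinearMap.proj l
  have hg : ‖g‖ ≤ 1 := by
    refine g.opNorm_le_bound zero_le_one fun y => ?_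
    rw [one_mul]
    exact norm_le_pi_norm y l
  have hxl := hpos x hx l
  have ho : IsOpen (g ⁻¹' Set.Ioi 0) := isOpen_Ioi.preimage g.continuous
  have hc : ContDiffOn ℝ n (fun y : ℝ => y ^ c) (Set.Ioi 0) := fun y hy =>
    (Real.contDiffAt_rpow_const_of_ne (ne_of_gt hy)).contDiffWithinAt
  have h := g.iteratedFDerivWithin_comp_right (x := x) hc isOpen_Ioi.uniqueDiffOn ho.uniqueDiffOn
    hxl (i := n) le_rfl
  rw [iteratedFDerivWithin_of_isOpen _ ho hxl, iteratedFDerivWithin_of_isOpen _ isOpen_Ioi hxl] at h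
  rw [iteratedFDerivWithin_of_isOpen _ hU hx]
  change iteratedFDeriv ℝ n (fun x : Fin d → ℝ => x l ^ c) x = _ at h
  rw [h]
  refine (ContinuousMultilinearMap.norm_compContinuousLinearMap_le _ _).trans ?_
  rw [norm_iteratedFDeriv_eq_norm_iteratedDeriv, iteratedDeriv_eq_iterate,
    Real.iter_deriv_rpow_const, norm_mul, Real.norm_eq_abs, Real.norm_eq_abs,
    show g x = x l from rfl, abs_of_nonneg (Real.rpow_nonneg hxl.le _)]
  refine mul_le_of_le_one_right (mul_nonneg (abs_nonneg _) (Real.rpow_nonneg hxl.le _)) ?_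
  exact Finset.prod_le_one (fun _ _ => norm_nonneg _) fun _ _ => hg

lemma sum_countPerms (n : ℕ) :
    ∑ p ∈ (Finset.univ : Finset (Fin d)).sym n, ((p : Multiset (Fin d)).countPerms : ℝ) =
      (d : ℝ) ^ n := by
  have h := Finset.sum_pow (s := (Finset.univ : Finset (Fin d))) (fun _ => (1 : ℝ)) n
  simpa using h.symm

lemma norm_iteratedFDerivWithin_monomial_le {U : Set (Fin d → ℝ)} (hU : IsOpen U)
    (hpos : ∀ x ∈ U, ∀ l, 0 < x l) (a : ℝ) (c : Fin d → ℝ) (n : ℕ) {x : Fin d → ℝ} (hx : x ∈ U)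
    {P Λ : ℝ} (hP0 : 0 ≤ P) (hΛ : ∀ l, |c l| + n ≤ Λ)
    (hP : ∀ ν : Fin d → ℕ, ∑ l, ν l = n → (∀ l, ν l ≠ 0 → c l ≠ 0) →
      |a| * ∏ l, x l ^ (c l - ν l) ≤ P) :
    ‖iteratedFDerivWithin ℝ n (fun x : Fin d → ℝ => a * ∏ l, x l ^ c l) U x‖ ≤
      P * (d * Λ) ^ n := by
  have hcd : ∀ l, ContDiffOn ℝ n (fun x : Fin d → ℝ => x l ^ c l) U := fun l =>
    contDiffOn_coord_rpow hpos l (c l)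
  have h1 := iteratedFDerivWithin_const_smul_apply (a := a)
    (contDiffOn_prod (t := Finset.univ) (fun l _ => hcd l) x hx) hU.uniqueDiffOn hx
  change iteratedFDerivWithin ℝ n (fun x : Fin d → ℝ => a * ∏ l, x l ^ c l) U x = _ at h1
  rw [h1, norm_smul, Real.norm_eq_abs]
  have h2 := norm_iteratedFDerivWithin_prod_le (u := Finset.univ) (fun l _ => hcd l)
    hU.uniqueDiffOn hx (n := n) le_rfl
  refine (mul_le_mul_of_nonneg_left h2 (abs_nonneg a)).trans ?_
  rw [Finset.mul_sum, mul_pow, ← sum_countPerms, Finset.sum_mul, Finset.mul_sum]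
  refine Finset.sum_le_sum fun p hp => ?_
  have hcard : ∑ l, Multiset.count l (p : Multiset (Fin d)) = n := by
    rw [Multiset.sum_count_eq_card (fun a _ => Finset.mem_univ a), Sym.card_coe]
  set ν : Fin d → ℕ := fun l => Multiset.count l (p : Multiset (Fin d)) with hν
  have hle : ∀ l, ν l ≤ n := fun l => hcard ▸ Finset.single_le_sum
    (f := ν) (fun _ _ => Nat.zero_le _) (Finset.mem_univ l)
  have hterm : |a| * ∏ l, ‖iteratedFDerivWithin ℝ (ν l) (fun x : Fin d → ℝ => x l ^ c l) U x‖ ≤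
      P * Λ ^ n := by
    calc |a| * ∏ l, ‖iteratedFDerivWithin ℝ (ν l) (fun x : Fin d → ℝ => x l ^ c l) U x‖
        ≤ |a| * ∏ l, |(descPochhammer ℝ (ν l)).eval (c l)| * x l ^ (c l - ν l) := by
          gcongr with l
          exact norm_iteratedFDerivWithin_coord_rpow_le hU hpos l (c l) (ν l) hx
      _ = (|a| * ∏ l, x l ^ (c l - ν l)) * ∏ l, |(descPochhammer ℝ (ν l)).eval (c l)| := by
          rw [Finset.prod_mul_distrib]; ring
      _ ≤ P * Λ ^ n := by
          by_cases h0 : ∀ l, ν l ≠ 0 → c l ≠ 0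
          · refine mul_le_mul (hP ν hcard h0) ?_ (Finset.prod_nonneg fun _ _ => abs_nonneg _) hP0
            rw [← hcard, ← Finset.prod_pow_eq_pow_sum]
            refine Finset.prod_le_prod (fun _ _ => abs_nonneg _) fun l _ => ?_
            refine (abs_descPochhammer_eval_le _ _).trans ?_
            have : (ν l : ℝ) ≤ n := by exact_mod_cast hle l
            gcongr
            exact le_trans (by gcongr) (hΛ l)
          · push Not at h0
            obtain ⟨l, hl, hcl⟩ := h0
            have hz : |(descPochhammer ℝ (ν l)).eval (c l)| = 0 := by
              rw [hcl, descPochhammer_eval_eq_prod_range, abs_eq_zero]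
              exact Finset.prod_eq_zero (Finset.mem_range.2 (Nat.pos_of_ne_zero hl)) (by simp)
            rw [Finset.prod_eq_zero (f := fun l => |(descPochhammer ℝ (ν l)).eval (c l)|)
              (Finset.mem_univ l) hz, mul_zero]
            rcases Nat.eq_zero_or_pos n with rfl | hn
            · simpa using hP0
            · exact mul_nonneg hP0 (pow_nonneg (le_trans (by positivity) (hΛ l)) n)
  calc |a| * ((p : Multiset (Fin d)).countPerms *
        ∏ l, ‖iteratedFDerivWithin ℝ (ν l) (fun x : Fin d → ℝ => x l ^ c l) U x‖)
      = (p : Multiset (Fin d)).countPerms *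
        (|a| * ∏ l, ‖iteratedFDerivWithin ℝ (ν l) (fun x : Fin d → ℝ => x l ^ c l) U x‖) := by ring
    _ ≤ (p : Multiset (Fin d)).countPerms * (P * Λ ^ n) := by gcongr
    _ = _ := by ring

/-- The `q`-th root of a monomial that is bounded, and bounded by the variables it contains, does
not become large when it is divided by a product of few factors `x l`. -/
lemma root_monomial_div_le {a a' B : ℝ} {μ : Fin d → ℝ} {R : Fin d → ℕ} {q r : ℕ} (hq : 1 ≤ q)
    (hr : 1 ≤ r) (hB : 1 ≤ B) (hR : ∀ l, q * r ≤ R l) (ha' : |a'| ≤ |a| ^ (1 / q : ℝ))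
    {x : Fin d → ℝ} (hx : ∀ l, 0 < x l)
    (hv : |a| * ∏ l, (x l ^ R l) ^ μ l ≤ B)
    (hvl : ∀ l, μ l ≠ 0 → |a| * ∏ l, (x l ^ R l) ^ μ l ≤ B * x l ^ R l)
    {ν : Fin d → ℕ} (hν : ∑ l, ν l ≤ r) (hνμ : ∀ l, ν l ≠ 0 → μ l ≠ 0) :
    |a'| * ∏ l, x l ^ (μ l * R l / q - ν l) ≤ B := by
  have hq0 : (0 : ℝ) < q := by exact_mod_cast hq
  have hr0 : (0 : ℝ) < r := by exact_mod_cast hr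
  have hprod : ∏ l, x l ^ (μ l * R l / q - ν l) =
      (∏ l, (x l ^ R l) ^ μ l) ^ (1 / q : ℝ) / ∏ l, x l ^ ν l := by
    rw [← Real.finsetProd_rpow _ _ fun l _ => Real.rpow_nonneg (pow_nonneg (hx l).le _) _,
      ← Finset.prod_div_distrib]
    refine Finset.prod_congr rfl fun l _ => ?_
    rw [Real.rpow_sub (hx l), Real.rpow_natCast, ← Real.rpow_natCast (x l) (R l),
      ← Real.rpow_mul (hx l).le, ← Real.rpow_mul (hx l).le]
    congr 2
    ring
  have hprodpos : 0 < ∏ l, (x l ^ R l) ^ μ l :=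
    Finset.prod_pos fun l _ => Real.rpow_pos_of_pos (pow_pos (hx l) _) _
  set v := |a| * ∏ l, (x l ^ R l) ^ μ l with hvdef
  rcases eq_or_ne a 0 with ha | ha
  · have : a' = 0 := by
      rw [ha, abs_zero, Real.zero_rpow (by positivity)] at ha'
      exact abs_nonpos_iff.1 ha'
    rw [this, abs_zero, zero_mul]
    linarith
  have hv0 : 0 < v := mul_pos (abs_pos.2 ha) hprodpos
  have hρ0 : 0 < v / B := by positivity
  have hρ1 : v / B ≤ 1 := (div_le_one (by positivity)).2 hv
  set τ := (v / B) ^ (1 / (q * r) : ℝ) with hτ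
  have hτ0 : 0 < τ := Real.rpow_pos_of_pos hρ0 _
  have hτ1 : τ ≤ 1 := Real.rpow_le_one hρ0.le hρ1 (by positivity)
  have hτqr : τ ^ (q * r) = v / B := by
    rw [hτ, ← Real.rpow_natCast, ← Real.rpow_mul hρ0.le]
    push_cast
    rw [one_div, inv_mul_cancel₀ (by positivity), Real.rpow_one]
  have hτr : τ ^ r = (v / B) ^ (1 / q : ℝ) := by
    rw [hτ, ← Real.rpow_natCast, ← Real.rpow_mul hρ0.le]
    congr 1
    field_simp
  have hxτ : ∀ l, μ l ≠ 0 → τ ≤ x l := fun l hl => by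
    refine le_of_pow_le_pow_left₀ (n := R l) ?_ (hx l).le ?_
    · have := hR l; have := Nat.mul_le_mul hq hr; lia
    · calc τ ^ R l ≤ τ ^ (q * r) := pow_le_pow_of_le_one hτ0.le hτ1 (hR l)
        _ = v / B := hτqr
        _ ≤ x l ^ R l := by
          rw [div_le_iff₀ (by positivity), mul_comm]
          exact hvl l hl
  have hden : (v / B) ^ (1 / q : ℝ) ≤ ∏ l, x l ^ ν l := by
    calc (v / B) ^ (1 / q : ℝ) = τ ^ r := hτr.symm
      _ ≤ τ ^ ∑ l, ν l := pow_le_pow_of_le_one hτ0.le hτ1 hν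
      _ = ∏ l, τ ^ ν l := (Finset.prod_pow_eq_pow_sum _ _ _).symm
      _ ≤ ∏ l, x l ^ ν l := by
        refine Finset.prod_le_prod (fun _ _ => by positivity) fun l _ => ?_
        by_cases hl : ν l = 0
        · simp [hl]
        · exact pow_le_pow_left₀ hτ0.le (hxτ l (hνμ l hl)) _
  have hρq : 0 < (v / B) ^ (1 / q : ℝ) := Real.rpow_pos_of_pos hρ0 _
  rw [hprod, ← mul_div_assoc, div_le_iff₀ (hρq.trans_le hden)]
  calc |a'| * (∏ l, (x l ^ R l) ^ μ l) ^ (1 / q : ℝ)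
      ≤ |a| ^ (1 / q : ℝ) * (∏ l, (x l ^ R l) ^ μ l) ^ (1 / q : ℝ) := by
        gcongr
    _ = v ^ (1 / q : ℝ) := (Real.mul_rpow (abs_nonneg _) hprodpos.le).symm
    _ = B ^ (1 / q : ℝ) * (v / B) ^ (1 / q : ℝ) := by
        rw [← Real.mul_rpow (by positivity) hρ0.le, mul_div_cancel₀ _ (by positivity)]
    _ ≤ B * (v / B) ^ (1 / q : ℝ) := by
        gcongr
        refine (Real.rpow_le_rpow_of_exponent_le hB ?_).trans_eq (Real.rpow_one B)
        rw [div_le_one hq0]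
        exact_mod_cast hq
    _ ≤ B * ∏ l, x l ^ ν l := by gcongr

lemma geomBound_root_monomial {a a' B Q S : ℝ} {μ : Fin d → ℝ} {R : Fin d → ℕ} {q r : ℕ}
    (hq : 1 ≤ q) (hr : 1 ≤ r) (hB : 1 ≤ B) (hR : ∀ l, q * r ≤ R l) (hRS : ∀ l, (R l : ℝ) ≤ S)
    (hQ : ∀ l, |μ l| ≤ Q) (ha' : |a'| ≤ |a| ^ (1 / q : ℝ))
    {U : Set (Fin d → ℝ)} (hU : IsOpen U) (hpos : ∀ x ∈ U, ∀ l, 0 < x l)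
    (hv : ∀ x ∈ U, |a| * ∏ l, (x l ^ R l) ^ μ l ≤ B)
    (hvl : ∀ x ∈ U, ∀ l, μ l ≠ 0 → |a| * ∏ l, (x l ^ R l) ^ μ l ≤ B * x l ^ R l) :
    GeomBound B (d * ((Q + 1) * S)) r U (fun x => a' * ∏ l, x l ^ (μ l * R l / q)) := by
  have hq1 : (1 : ℝ) ≤ q := by exact_mod_cast hq
  refine ⟨contDiffOn_const.mul (contDiffOn_prod fun l _ => contDiffOn_coord_rpow hpos l _),
    fun n _ hn x hx => ?_⟩
  refine norm_iteratedFDerivWithin_monomial_le hU hpos a' _ n hx (by linarith) (fun l => ?_)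
    fun ν hν hνμ => ?_
  · have hrS : (r : ℝ) ≤ R l := by
      exact_mod_cast (Nat.le_mul_of_pos_left r hq).trans (hR l)
    have hnr : (n : ℝ) ≤ r := by exact_mod_cast hn
    have hS : 0 ≤ S := (Nat.cast_nonneg _).trans (hRS l)
    have : |μ l * R l / q| ≤ Q * S := by
      rw [abs_div, abs_mul, Nat.abs_cast, Nat.abs_cast]
      refine (div_le_self (by positivity) hq1).trans ?_
      exact mul_le_mul (hQ l) (hRS l) (by positivity) ((abs_nonneg _).trans (hQ l))
    linarith [hRS l]
  · refine root_monomial_div_le hq hr hB hR ha' (hpos x hx) (hv x hx) (hvl x hx) (hν ▸ hn)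
      fun l hl h0 => hνμ l hl ?_
    simp [h0]

end Monomial

/-! ### Definability of preimages under coordinatewise powers -/

/-- The map that raises the `i`-th coordinate to the power `e i`. -/
def coordPow (e : ℕ → ℕ) {j : ℕ} (y : Fin j → ℝ) : Fin j → ℝ := fun i => y i ^ e i

lemma continuous_coordPow (e : ℕ → ℕ) {j : ℕ} :
    Continuous (coordPow e : (Fin j → ℝ) → Fin j → ℝ) :=
  continuous_pi fun i => (continuous_apply i).pow _

section Definability

open FirstOrder FirstOrder.Language

variable (F : (n : ℕ) → Set ((Fin n → ℝ) → ℝ)) (K : Subfield ℝ) {n : ℕ}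

lemma exists_term_pow (i : Fin n) (a : ℕ) :
    ∃ t : ((powLang F K)[[(Set.univ : Set ℝ)]]).Term (Fin n), ∀ v : Fin n → ℝ,
      t.realize v = v i ^ a := by
  induction a with
  | zero =>
    refine ⟨Term.func (l := 0) (Sum.inl (PowFunc.one : (powLang F K).Functions 0)) ![],
      fun v => ?_⟩
    rw [pow_zero]
    rfl
  | succ a ih =>
    obtain ⟨t, ht⟩ := ih
    refine ⟨Functions.apply₂ (Sum.inl (PowFunc.mul : (powLang F K).Functions 2)) t (Term.var i),
      fun v => ?_⟩
    rw [pow_succ, ← ht v]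
    rfl

lemma isDefinable_preimage_coordPow (e : ℕ → ℕ) {S : Set (Fin n → ℝ)} (hS : IsDefinable F K S) :
    IsDefinable F K (coordPow e ⁻¹' S) := by
  obtain ⟨φ, rfl⟩ := hS
  choose t ht using fun i : Fin n => exists_term_pow F K i (e i)
  refine ⟨BoundedFormula.subst φ t, ?_⟩
  ext v
  rw [Set.mem_preimage, Set.mem_ofPred_eq, Set.mem_ofPred_eq, Formula.Realize, Formula.Realize,
    BoundedFormula.realize_subst]
  simp only [ht]
  rfl

lemma isDefinable_term_lt_term (s t : ((powLang F K)[[(Set.univ : Set ℝ)]]).Term (Fin n)) :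
    IsDefinable F K {v : Fin n → ℝ | s.realize v < t.realize v} := by
  refine ⟨Relations.formula₂ (Sum.inl (PowRel.lt : (powLang F K).Relations 2)) s t, ?_⟩
  ext v
  rw [Set.mem_ofPred_eq, Set.mem_ofPred_eq]
  refine Iff.trans ?_ (Formula.realize_rel₂ (L := (powLang F K)[[(Set.univ : Set ℝ)]])
    (M := ℝ)).symm
  exact Iff.rfl

lemma isDefinable_zero_lt_coord (i : Fin n) : IsDefinable F K {y : Fin n → ℝ | 0 < y i} :=
  isDefinable_term_lt_term F K
    (Term.func (l := 0) (Sum.inl (PowFunc.zero : (powLang F K).Functions 0)) ![]) (Term.var i)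

lemma isDefinable_coord_lt_zero (i : Fin n) : IsDefinable F K {y : Fin n → ℝ | y i < 0} :=
  isDefinable_term_lt_term F K (Term.var i)
    (Term.func (l := 0) (Sum.inl (PowFunc.zero : (powLang F K).Functions 0)) ![])

/-- If `α ≥ 0` is definable on `D`, then so is the `N`-th root of its pullback under a
coordinatewise power map, on the part of the preimage of `D` where the coordinates from the `k`-th
on are positive. -/
lemma isDefinableFun_root (e : ℕ → ℕ) (k : ℕ) {N : ℕ} (hN : N ≠ 0) {D D' : Set (Fin n → ℝ)}
    {α : (Fin n → ℝ) → ℝ} (hα : IsDefinableFun F K D α) (hα0 : ∀ y ∈ D, 0 ≤ α y)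
    (hD' : ∀ y, y ∈ D' ↔ (∀ i : Fin n, k ≤ i → 0 < y i) ∧ coordPow e y ∈ D) :
    IsDefinableFun F K D' (fun y => |α (coordPow e y)| ^ (1 / N : ℝ)) := by
  have h1 := isDefinable_preimage_coordPow F K (fun i => if i = n then N else e i) hα
  have h2 : IsDefinable F K (⋂ i : Fin n,
      (if k ≤ i then {p : Fin (n + 1) → ℝ | 0 < p i.castSucc} else Set.univ)) :=
    Set.definable_iInter_of_finite fun i => by
      split_ifs
      · exact isDefinable_zero_lt_coord F K _
      · exact Set.definable_univ
  have h3 := (isDefinable_coord_lt_zero F K (Fin.last n)).compl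
  have h := (h1.inter h2).inter h3
  unfold IsDefinableFun IsDefinable
  convert h using 1
  ext p
  have hinit : Fin.init (coordPow (fun i => if i = n then N else e i) p) =
      coordPow e (Fin.init p) := by
    funext i
    simp [Fin.init, coordPow, i.2.ne]
  have hlast : coordPow (fun i => if i = n then N else e i) p (Fin.last n) =
      p (Fin.last n) ^ N := by simp [coordPow]
  have hpos : (p ∈ ⋂ i : Fin n,
      (if k ≤ i then {p : Fin (n + 1) → ℝ | 0 < p i.castSucc} else Set.univ)) ↔
      ∀ i : Fin n, k ≤ i → 0 < Fin.init p i := by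
    rw [Set.mem_iInter]
    refine forall_congr' fun i => ?_
    split_ifs with hi
    · simp [hi, Fin.init]
    · simp [hi]
  rw [Set.mem_inter_iff, Set.mem_inter_iff, hpos]
  simp only [Set.mem_ofPred_eq, Set.mem_preimage, hinit, hlast, hD', Set.mem_compl_iff, not_lt]
  constructor
  · rintro ⟨⟨hp, hD⟩, hv⟩
    refine ⟨⟨⟨hD, ?_⟩, hp⟩, ?_⟩
    · rw [hv, one_div, Real.rpow_inv_natCast_pow (abs_nonneg _) hN, abs_of_nonneg (hα0 _ hD)]
    · rw [hv]
      positivity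
  · rintro ⟨⟨⟨hD, hv⟩, hp⟩, h0⟩
    refine ⟨⟨hp, hD⟩, ?_⟩
    rw [← hv, abs_of_nonneg (by positivity), one_div, Real.pow_rpow_inv_natCast h0 hN]

end Definability

/-! ### Cells and their projections -/

section Cell

variable {F : (n : ℕ) → Set ((Fin n → ℝ) → ℝ)} {K : Subfield ℝ} {n : ℕ}
  {c : (i : Fin n) → CoordCond (i : ℕ)}

lemma mem_cellSet_succ {j : ℕ} (hj : j + 1 ≤ n) (y : Fin (j + 1) → ℝ) :
    y ∈ cellSet c (j + 1) hj ↔ Fin.init y ∈ cellSet c j (Nat.le_of_succ_le hj) ∧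
      (c ⟨j, hj⟩).Holds (Fin.init y) (y (Fin.last j)) :=
  Fin.forall_fin_succ'

lemma CoordCond.Admissible.exists_holds {j : ℕ} {cj : CoordCond j} {D : Set (Fin j → ℝ)}
    (h : cj.Admissible F K D) {y : Fin j → ℝ} (hy : y ∈ D) : ∃ z, cj.Holds y z := by
  cases cj with
  | graph α => exact ⟨α y, rfl⟩
  | free => exact ⟨0, trivial⟩
  | above α => exact exists_gt (α y)
  | below β => exact exists_lt (β y)
  | between α β => exact exists_between (h.2.2 y hy)

lemma exists_mem_cellSet_take_eq
    (hc : ∀ i : Fin n, (c i).Admissible F K (cellSet c (i : ℕ) i.2.le)) {j : ℕ} (hj : j ≤ n)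
    {y : Fin j → ℝ} (hy : y ∈ cellSet c j hj) :
    ∃ p ∈ cellSet c n le_rfl, Fin.take j hj p = y := by
  induction hd : n - j generalizing j with
  | zero =>
    obtain rfl : j = n := by lia
    exact ⟨y, hy, rfl⟩
  | succ d ih =>
    have hj' : j + 1 ≤ n := by lia
    obtain ⟨z, hz⟩ := (hc ⟨j, hj'⟩).exists_holds hy
    obtain ⟨p, hp, hpy⟩ := ih hj' (y := Fin.snoc y z)
      ((mem_cellSet_succ hj' _).2 (by simpa using ⟨hy, hz⟩)) (by lia)
    refine ⟨p, hp, ?_⟩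
    have : Fin.take j hj p = Fin.init (Fin.take (j + 1) hj' p) := rfl
    rw [this, hpy, Fin.init_snoc]

lemma image_take_cellSet
    (hc : ∀ i : Fin n, (c i).Admissible F K (cellSet c (i : ℕ) i.2.le)) {j : ℕ} (hj : j ≤ n) :
    Fin.take j hj '' cellSet c n le_rfl = cellSet c j hj := by
  ext y
  constructor
  · rintro ⟨p, hp, rfl⟩ i
    exact hp (Fin.castLE hj i)
  · intro hy
    obtain ⟨p, hp, rfl⟩ := exists_mem_cellSet_take_eq hc hj hy
    exact ⟨p, hp, rfl⟩

end Cell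

section CellWithWalls

variable {F : (n : ℕ) → Set ((Fin n → ℝ) → ℝ)} {K : Subfield ℝ} {k m : ℕ}
  {c : (i : Fin (k + m)) → CoordCond (i : ℕ)}
  {α β : (i : Fin m) → (Fin (k + (i : ℕ)) → ℝ) → ℝ}

lemma init_append_eq {i : ℕ} (t : Fin k → ℝ) (x : Fin (i + 1) → ℝ) :
    Fin.init (n := k + i) (α := fun _ => ℝ) (Fin.append t x : Fin (k + (i + 1)) → ℝ) =
      Fin.append t (Fin.init (α := fun _ => ℝ) x) :=
  Fin.take_append_right i (Nat.le_succ i) t x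

lemma isOpen_fiber_cellSet
    (hc : ∀ i : Fin (k + m), (c i).Admissible F K (cellSet c (i : ℕ) i.2.le))
    (hw : ∀ i : Fin m, c (Fin.natAdd k i) = CoordCond.between (α i) (β i))
    (t : Fin k → ℝ) {i : ℕ} (hi : i ≤ m) :
    IsOpen (fiber (cellSet c (k + i) (Nat.add_le_add_left hi k)) t) := by
  induction i with
  | zero => exact isOpen_discrete _
  | succ i ih =>
    have ih := ih (Nat.le_of_succ_le hi)
    have ha := hc (Fin.natAdd k ⟨i, hi⟩)
    rw [hw] at ha
    obtain ⟨⟨hα, -⟩, ⟨hβ, -⟩, -⟩ := ha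
    set D := cellSet c (k + i) (Nat.add_le_add_left (Nat.le_of_succ_le hi) k) with hD
    have happ : Continuous fun x : Fin i → ℝ => (Fin.append t x : Fin (k + i) → ℝ) := by
      refine continuous_pi fun l => ?_
      refine Fin.addCases (fun l => ?_) (fun l => ?_) l
      · simpa using continuous_const
      · simpa using continuous_apply l
    have hα' : ContinuousOn (fiberFun (α ⟨i, hi⟩) t) (fiber D t) :=
      hα.comp happ.continuousOn fun x hx => hx
    have hβ' : ContinuousOn (fiberFun (β ⟨i, hi⟩) t) (fiber D t) :=
      hβ.comp happ.continuousOn fun x hx => hx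
    have hinit : Continuous (Fin.init : (Fin (i + 1) → ℝ) → Fin i → ℝ) :=
      continuous_pi fun l => continuous_apply _
    have hset : fiber (cellSet c (k + (i + 1)) (Nat.add_le_add_left hi k)) t =
        {x : Fin (i + 1) → ℝ | (Fin.init x : Fin i → ℝ) ∈ fiber D t ∧
          fiberFun (α ⟨i, hi⟩) t (Fin.init x) < x (Fin.last i) ∧
          x (Fin.last i) < fiberFun (β ⟨i, hi⟩) t (Fin.init x)} := by
      ext x
      refine (mem_cellSet_succ (j := k + i) _ _).trans ?_
      rw [init_append_eq]
      change _ ∧ (c (Fin.natAdd k ⟨i, hi⟩)).Holds _ _ ↔ _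
      rw [hw]
      have : (Fin.append t x : Fin (k + (i + 1)) → ℝ) (Fin.last (k + i)) = x (Fin.last i) :=
        Fin.append_right t x (Fin.last i)
      rw [this]
      rfl
    rw [hset]
    rw [isOpen_iff_mem_nhds]
    rintro x ⟨hx, hx1, hx2⟩
    have hn : fiber D t ∈ nhds (Fin.init x) := ih.mem_nhds hx
    have e0 := hinit.continuousAt.preimage_mem_nhds hn
    have e1 := ((hα'.continuousAt hn).comp (f := Fin.init) hinit.continuousAt).eventually_lt
      (continuous_apply (Fin.last i)).continuousAt hx1
    have e2 := ((continuous_apply (Fin.last i)).continuousAt (x := x)).eventually_lt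
      ((hβ'.continuousAt hn).comp (f := Fin.init) hinit.continuousAt) hx2
    filter_upwards [e0, e1, e2] with y h0 h1 h2 using ⟨h0, h1, h2⟩

lemma coord_mem_Ioo_of_mem_cellSet {T : Set (Fin k → ℝ)}
    (hc : ∀ i : Fin (k + m), (c i).Admissible F K (cellSet c (i : ℕ) i.2.le))
    (hCT : cellSet c (k + m) le_rfl ⊆ cubeOver T m) {j : ℕ} (hj : j ≤ k + m) {y : Fin j → ℝ}
    (hy : y ∈ cellSet c j hj) (l : Fin j) (hl : k ≤ l) : y l ∈ Set.Ioo (0 : ℝ) 1 := by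
  obtain ⟨p, hp, rfl⟩ := exists_mem_cellSet_take_eq hc hj hy
  have h := (hCT hp).2 ⟨l - k, by lia⟩
  have heq : Fin.natAdd k (⟨l - k, by lia⟩ : Fin m) = Fin.castLE hj l := by
    ext
    simp
    lia
  rw [xPart, heq] at h
  exact h

lemma walls_mem_Icc {T : Set (Fin k → ℝ)}
    (hc : ∀ i : Fin (k + m), (c i).Admissible F K (cellSet c (i : ℕ) i.2.le))
    (hw : ∀ i : Fin m, c (Fin.natAdd k i) = CoordCond.between (α i) (β i))
    (hCT : cellSet c (k + m) le_rfl ⊆ cubeOver T m) (i : Fin m) {y : Fin (k + (i : ℕ)) → ℝ}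
    (hy : y ∈ cellSet c (k + i) (Nat.add_le_add_left i.2.le k)) :
    0 ≤ α i y ∧ α i y < β i y ∧ β i y ≤ 1 := by
  have ha := hc (Fin.natAdd k i)
  rw [hw] at ha
  have hlt : α i y < β i y := ha.2.2 y hy
  have hsub : Set.Ioo (α i y) (β i y) ⊆ Set.Ioo 0 1 := fun z hz => by
    have hmem : (Fin.snoc y z : Fin (k + i + 1) → ℝ) ∈
        cellSet c (k + i + 1) (Nat.add_le_add_left i.2 k) := by
      rw [mem_cellSet_succ]
      refine ⟨by simpa using hy, ?_⟩
      change (c (Fin.natAdd k i)).Holds _ _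
      rw [hw]
      simpa [CoordCond.Holds] using hz
    simpa using coord_mem_Ioo_of_mem_cellSet hc hCT _ hmem (Fin.last _) (by simp)
  have := (Set.Ioo_subset_Ioo_iff hlt).1 hsub
  exact ⟨this.1, hlt, this.2⟩

/-! ### The pullback of a cell -/

/-- The exponents of the substitution `powSub r`, as a function of the coordinate. -/
def powExp (k m r : ℕ) (i : ℕ) : ℕ := if i < k then 1 else r ^ (m - (i - k))

lemma powSub_eq_coordPow (r : ℕ) (p : Fin (k + m) → ℝ) :
    powSub r p = coordPow (powExp k m r) p := by
  funext l
  refine Fin.addCases (fun l => ?_) (fun l => ?_) l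
  · simp [powSub, coordPow, powExp, tPart]
  · simp [powSub, coordPow, powExp, xPart]

lemma coordPow_powExp_of_le {r j : ℕ} (hj : j ≤ k) (y : Fin j → ℝ) :
    coordPow (powExp k m r) y = y := by
  funext l
  simp [coordPow, powExp, l.2.trans_le hj]

/-- The wall of `x_i` of the pullback of a cell with wall `α` under `powSub r`. -/
noncomputable def rootWall (k m r : ℕ) (i : ℕ) (α : (Fin (k + i) → ℝ) → ℝ) :
    (Fin (k + i) → ℝ) → ℝ :=
  fun y => |α (coordPow (powExp k m r) y)| ^ (1 / (r ^ (m - i) : ℕ) : ℝ)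

/-- The conditions that describe the pullback of a cell under `powSub r`. -/
noncomputable def pullCond (r : ℕ) (c : (i : Fin (k + m)) → CoordCond (i : ℕ))
    (α β : (i : Fin m) → (Fin (k + (i : ℕ)) → ℝ) → ℝ) : (i : Fin (k + m)) → CoordCond (i : ℕ) :=
  Fin.addCases (motive := fun i => CoordCond (i : ℕ)) (fun i => c (Fin.castAdd m i))
    (fun i => CoordCond.between (rootWall k m r i (α i)) (rootWall k m r i (β i)))

lemma mem_cellSet_pullCond {T : Set (Fin k → ℝ)} {r : ℕ} (hr : 0 < r)
    (hc : ∀ i : Fin (k + m), (c i).Admissible F K (cellSet c (i : ℕ) i.2.le))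
    (hw : ∀ i : Fin m, c (Fin.natAdd k i) = CoordCond.between (α i) (β i))
    (hCT : cellSet c (k + m) le_rfl ⊆ cubeOver T m) {j : ℕ} (hj : j ≤ k + m) (y : Fin j → ℝ) :
    y ∈ cellSet (pullCond r c α β) j hj ↔
      (∀ l : Fin j, k ≤ l → 0 < y l) ∧ coordPow (powExp k m r) y ∈ cellSet c j hj := by
  induction j with
  | zero => exact ⟨fun _ => ⟨fun l => l.elim0, fun l => l.elim0⟩, fun _ l => l.elim0⟩
  | succ j ih =>
    have hinit : Fin.init (coordPow (powExp k m r) y) = coordPow (powExp k m r) (Fin.init y) := rfl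
    rw [mem_cellSet_succ, mem_cellSet_succ, ih, hinit, Fin.forall_fin_succ']
    have hlast : coordPow (powExp k m r) y (Fin.last j) = y (Fin.last j) ^ powExp k m r j := rfl
    rcases lt_or_ge j k with hjk | hjk
    · have hcj : pullCond r c α β ⟨j, hj⟩ = c ⟨j, hj⟩ :=
        Fin.addCases_left (motive := fun i => CoordCond (i : ℕ)) (⟨j, hjk⟩ : Fin k)
      rw [hcj, coordPow_powExp_of_le hjk.le, hlast]
      have he : powExp k m r j = 1 := by simp [powExp, hjk]
      rw [he, pow_one]
      have h1 : ¬ k ≤ ((Fin.last j : Fin (j + 1)) : ℕ) := by simpa using hjk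
      simp only [h1, false_imp_iff, and_true]
      exact and_assoc
    · obtain ⟨i, rfl⟩ := Nat.exists_eq_add_of_le hjk
      have hi : i < m := by lia
      have hcj : pullCond r c α β ⟨k + i, hj⟩ = CoordCond.between
          (rootWall k m r i (α ⟨i, hi⟩)) (rootWall k m r i (β ⟨i, hi⟩)) :=
        Fin.addCases_right (motive := fun i => CoordCond (i : ℕ)) (⟨i, hi⟩ : Fin m)
      have hcj' : c ⟨k + i, hj⟩ = CoordCond.between (α ⟨i, hi⟩) (β ⟨i, hi⟩) := hw ⟨i, hi⟩
      rw [hcj, hcj', hlast]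
      have he : powExp k m r (k + i) = r ^ (m - i) := by simp [powExp]
      have hN : r ^ (m - i) ≠ 0 := (Nat.pow_pos hr).ne'
      rw [he]
      have hkl : k ≤ ((Fin.last (k + i) : Fin (k + i + 1)) : ℕ) := by simp
      simp only [hkl, forall_const]
      simp only [CoordCond.Holds, rootWall]
      constructor
      · rintro ⟨⟨hpos, hD⟩, h1, h2⟩
        obtain ⟨hα0, hαβ, -⟩ := walls_mem_Icc hc hw hCT ⟨i, hi⟩ hD
        have h0 : 0 < y (Fin.last (k + i)) := lt_of_le_of_lt (by positivity) h1
        rw [abs_of_nonneg hα0, one_div] at h1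
        rw [abs_of_nonneg (hα0.trans hαβ.le), one_div] at h2
        refine ⟨⟨hpos, h0⟩, hD, ?_, ?_⟩
        · have := pow_lt_pow_left₀ h1 (by positivity) hN
          rwa [Real.rpow_inv_natCast_pow hα0 hN] at this
        · have := pow_lt_pow_left₀ h2 h0.le hN
          rwa [Real.rpow_inv_natCast_pow (hα0.trans hαβ.le) hN] at this
      · rintro ⟨⟨hpos, h0⟩, hD, h1, h2⟩
        obtain ⟨hα0, hαβ, -⟩ := walls_mem_Icc hc hw hCT ⟨i, hi⟩ hD
        refine ⟨⟨hpos, hD⟩, ?_, ?_⟩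
        · rw [abs_of_nonneg hα0, one_div]
          refine lt_of_pow_lt_pow_left₀ (r ^ (m - i)) h0.le ?_
          rwa [Real.rpow_inv_natCast_pow hα0 hN]
        · rw [abs_of_nonneg (hα0.trans hαβ.le), one_div]
          refine lt_of_pow_lt_pow_left₀ (r ^ (m - i))
            (Real.rpow_nonneg (hα0.trans hαβ.le) _) ?_
          rwa [Real.rpow_inv_natCast_pow (hα0.trans hαβ.le) hN]

lemma admissible_pullCond {T : Set (Fin k → ℝ)} {r : ℕ} (hr : 0 < r)
    (hc : ∀ i : Fin (k + m), (c i).Admissible F K (cellSet c (i : ℕ) i.2.le))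
    (hw : ∀ i : Fin m, c (Fin.natAdd k i) = CoordCond.between (α i) (β i))
    (hCT : cellSet c (k + m) le_rfl ⊆ cubeOver T m) (i : Fin (k + m)) :
    (pullCond r c α β i).Admissible F K (cellSet (pullCond r c α β) (i : ℕ) i.2.le) := by
  refine Fin.addCases (fun i => ?_) (fun i => ?_) i
  · have hset : cellSet (pullCond r c α β) (Fin.castAdd m i : ℕ) (Fin.castAdd m i).2.le =
        cellSet c (Fin.castAdd m i : ℕ) (Fin.castAdd m i).2.le := by
      ext y
      rw [mem_cellSet_pullCond hr hc hw hCT, coordPow_powExp_of_le i.2.le]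
      refine and_iff_right fun l hl => ?_
      exact absurd hl (not_le.2 (l.2.trans i.2))
    have hci : pullCond r c α β (Fin.castAdd m i) = c (Fin.castAdd m i) :=
      Fin.addCases_left (motive := fun i => CoordCond (i : ℕ)) i
    rw [hset, hci]
    exact hc _
  · have hci : pullCond r c α β (Fin.natAdd k i) = CoordCond.between
        (rootWall k m r i (α i)) (rootWall k m r i (β i)) :=
      Fin.addCases_right (motive := fun i => CoordCond (i : ℕ)) i
    rw [hci]
    have ha := hc (Fin.natAdd k i)
    rw [hw] at ha
    obtain ⟨⟨hα, hαd⟩, ⟨hβ, hβd⟩, hαβ⟩ := ha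
    have hN : r ^ (m - (i : ℕ)) ≠ 0 := (Nat.pow_pos hr).ne'
    have hmem := mem_cellSet_pullCond (α := α) (β := β) hr hc hw hCT
      (j := k + i) (Nat.add_le_add_left i.2.le k)
    have hwall := fun y hy => walls_mem_Icc hc hw hCT i (y := y) hy
    have hcont : ∀ {γ : (Fin (k + (i : ℕ)) → ℝ) → ℝ},
        ContinuousOn γ (cellSet c (k + i) (Nat.add_le_add_left i.2.le k)) →
        ContinuousOn (rootWall k m r i γ)
          (cellSet (pullCond r c α β) (k + i) (Nat.add_le_add_left i.2.le k)) := fun hγ =>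
      ((hγ.comp (continuous_coordPow _).continuousOn fun y hy =>
        ((hmem y).1 hy).2).abs).rpow_const fun _ _ => Or.inr (by positivity)
    refine ⟨⟨hcont hα, ?_⟩, ⟨hcont hβ, ?_⟩, fun y hy => ?_⟩
    · exact isDefinableFun_root F K _ k hN hαd (fun y hy => (hwall y hy).1) hmem
    · exact isDefinableFun_root F K _ k hN hβd
        (fun y hy => (hwall y hy).1.trans (hwall y hy).2.1.le) hmem
    · obtain ⟨h0, h1, -⟩ := hwall _ ((hmem y).1 hy).2
      simp only [rootWall]
      rw [abs_of_nonneg h0, abs_of_nonneg (h0.trans h1.le)]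
      exact Real.rpow_lt_rpow h0 h1 (by positivity)

lemma pullback_eq_cellSet {T : Set (Fin k → ℝ)} {r : ℕ} (hr : 0 < r)
    (hc : ∀ i : Fin (k + m), (c i).Admissible F K (cellSet c (i : ℕ) i.2.le))
    (hw : ∀ i : Fin m, c (Fin.natAdd k i) = CoordCond.between (α i) (β i))
    (hCT : cellSet c (k + m) le_rfl ⊆ cubeOver T m) :
    pullback T r (cellSet c (k + m) le_rfl) = cellSet (pullCond r c α β) (k + m) le_rfl := by
  ext p
  rw [mem_cellSet_pullCond hr hc hw hCT]
  change p ∈ cubeOver T m ∧ powSub r p ∈ _ ↔ _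
  rw [powSub_eq_coordPow]
  refine and_congr_left fun hp => ?_
  have hcube := hCT hp
  rw [← powSub_eq_coordPow] at hcube
  constructor
  · rintro ⟨-, h⟩ l
    refine Fin.addCases (fun l hl => ?_) (fun l _ => (h l).1) l
    simp only [Fin.val_castAdd] at hl
    exact absurd l.2 (by lia)
  · intro h
    refine ⟨?_, fun i => ⟨h (Fin.natAdd k i) (by simp), ?_⟩⟩
    · have := hcube.1
      rwa [show tPart (powSub r p) = tPart p from funext fun l => by simp [tPart, powSub]] at this
    · have := (hcube.2 i).2
      simp only [xPart, powSub, Fin.append_right] at this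
      exact lt_of_not_ge fun h1 => absurd this (not_lt.2 (one_le_pow₀ h1))

end CellWithWalls

/-! ### Partial derivatives -/

section Partial

variable {d : ℕ}

lemma abs_mpartial_le (ν : Fin d → ℕ) (f : (Fin d → ℝ) → ℝ) (x : Fin d → ℝ) :
    |mpartial ν f x| ≤ ‖iteratedFDeriv ℝ (∑ i, ν i) f x‖ := by
  refine ((iteratedFDeriv ℝ (∑ i, ν i) f x).le_opNorm _).trans_eq ?_
  rw [Finset.prod_eq_one fun j _ => ?_, mul_one]
  rw [Pi.norm_single, norm_one]

lemma mpartial_eq_of_sum_eq_zero {ν : Fin d → ℕ} (hν : ∑ i, ν i = 0) (f : (Fin d → ℝ) → ℝ)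
    (x : Fin d → ℝ) : mpartial ν f x = f x := by
  have key : ∀ (n : ℕ) (v : Fin n → Fin d → ℝ), n = 0 → iteratedFDeriv ℝ n f x v = f x := by
    rintro n v rfl
    exact iteratedFDeriv_zero_apply v
  exact key _ _ hν

lemma mpartial_single (l : Fin d) (f : (Fin d → ℝ) → ℝ) (x : Fin d → ℝ) :
    mpartial (Pi.single l 1) f x = fderiv ℝ f x (Pi.single l 1) := by
  have key : ∀ (n : ℕ) (v : Fin n → Fin d → ℝ), n = 1 → (∀ j, v j = Pi.single l 1) →
      iteratedFDeriv ℝ n f x v = fderiv ℝ f x (Pi.single l 1) := by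
    rintro n v rfl hv
    rw [iteratedFDeriv_one_apply, hv]
  refine key _ _ (by simp) fun j => ?_
  have h2 := (finSigmaFinEquiv.symm j : (i : Fin d) × Fin ((Pi.single l 1 : Fin d → ℕ) i)).2.2
  by_cases h : (finSigmaFinEquiv.symm j : (i : Fin d) × Fin ((Pi.single l 1 : Fin d → ℕ) i)).1 = l
  · rw [h]
  · exact absurd (h2.trans_eq (Pi.single_eq_of_ne h _)) (Nat.not_lt_zero _)

lemma mildUpTo_of_norm_le {A : ℝ} {r : ℕ} {U : Set (Fin d → ℝ)} (hU : IsOpen U)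
    {f : (Fin d → ℝ) → ℝ} (h1 : ∀ x ∈ U, |f x| ≤ 1) (hf : ContDiffOn ℝ r f U)
    (hb : ∀ n, 1 ≤ n → n ≤ r → ∀ x ∈ U,
      ‖iteratedFDerivWithin ℝ n f U x‖ ≤ A ^ n * n.factorial) :
    MildUpTo A 0 r U f := by
  refine ⟨1, one_pos, le_rfl, hf, fun ν hν x hx => ?_⟩
  simp only [zero_add, Real.rpow_one, one_mul]
  rcases Nat.eq_zero_or_pos (∑ i, ν i) with h0 | hpos
  · rw [mpartial_eq_of_sum_eq_zero h0, h0]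
    simpa using h1 x hx
  · refine (abs_mpartial_le ν f x).trans ?_
    rw [← iteratedFDerivWithin_of_isOpen _ hU hx]
    exact hb _ hpos (by exact_mod_cast hν) x hx

lemma mild_of_dim_eq_zero (hd : d = 0) (A : ℝ) {U : Set (Fin d → ℝ)}
    {f : (Fin d → ℝ) → ℝ} (h1 : ∀ x ∈ U, |f x| ≤ 1) : Mild A 0 U f := by
  subst hd
  refine ⟨1, one_pos, le_rfl, fun x _ => ?_, fun ν _ x hx => ?_⟩
  · rw [show f = fun _ => f x from funext fun y => congrArg f (Subsingleton.elim y x)]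
    exact contDiffWithinAt_const
  rw [mpartial_eq_of_sum_eq_zero (by simp)]
  simpa using h1 x hx

lemma fderiv_monomial_single {a : ℝ} {μ : Fin d → ℝ} {x : Fin d → ℝ} (hx : ∀ l, 0 < x l)
    {g : (Fin d → ℝ) → ℝ} (hg : g =ᶠ[nhds x] fun x => a * ∏ l, x l ^ μ l) (l : Fin d) :
    x l * fderiv ℝ g x (Pi.single l 1) = μ l * g x := by
  have hdiff : DifferentiableAt ℝ (fun x : Fin d → ℝ => a * ∏ l, x l ^ μ l) x := by
    have : ContDiffOn ℝ 1 (fun x : Fin d → ℝ => a * ∏ l, x l ^ μ l) {x | ∀ l, 0 < x l} :=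
      contDiffOn_const.mul (contDiffOn_prod fun l _ => contDiffOn_coord_rpow (fun _ h => h) l _)
    refine (this.contDiffAt ?_).differentiableAt one_ne_zero
    have ho : IsOpen {x : Fin d → ℝ | ∀ l, 0 < x l} := by
      simp only [Set.ofPred_forall]
      exact isOpen_iInter_of_finite fun l => isOpen_lt continuous_const (continuous_apply l)
    exact ho.mem_nhds hx
  have h1 : HasDerivAt (fun s => a * ∏ j, Function.update x l s j ^ μ j)
      (fderiv ℝ (fun x : Fin d → ℝ => a * ∏ l, x l ^ μ l) x (Pi.single l 1)) (x l) := by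
    have hu := hasDerivAt_update x l (x l)
    have hd' : HasFDerivAt (fun x : Fin d → ℝ => a * ∏ l, x l ^ μ l)
        (fderiv ℝ (fun x : Fin d → ℝ => a * ∏ l, x l ^ μ l) x) (Function.update x l (x l)) := by
      rw [Function.update_eq_self]
      exact hdiff.hasFDerivAt
    exact hd'.comp_hasDerivAt (x l) hu
  have h2 : HasDerivAt (fun s => a * ∏ j, Function.update x l s j ^ μ j)
      ((a * ∏ j ∈ Finset.univ.erase l, x j ^ μ j) * (μ l * x l ^ (μ l - 1))) (x l) := by
    have h := (Real.hasDerivAt_rpow_const (p := μ l) (Or.inl (hx l).ne')).const_mul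
      (a * ∏ j ∈ Finset.univ.erase l, x j ^ μ j)
    refine h.congr_of_eventuallyEq (Filter.Eventually.of_forall fun s => ?_)
    simp only
    rw [← Finset.mul_prod_erase _ _ (Finset.mem_univ l), Function.update_self, mul_assoc,
      mul_comm (s ^ μ l)]
    congr 2
    refine Finset.prod_congr rfl fun j hj => ?_
    rw [Function.update_of_ne (Finset.ne_of_mem_erase hj)]
  rw [hg.fderiv_eq, hg.eq_of_nhds, h1.unique h2, ← Finset.mul_prod_erase _ _ (Finset.mem_univ l),
    Real.rpow_sub_one (hx l).ne']
  field_simp [(hx l).ne']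

end Partial

/-! ### Prepared functions -/

section Prepared

variable {F : (n : ℕ) → Set ((Fin n → ℝ) → ℝ)} {K : Subfield ℝ} {k d N : ℕ}

lemma tPart_append (t : Fin k → ℝ) (x : Fin d → ℝ) : tPart (Fin.append t x) = t :=
  funext fun l => Fin.append_left t x l

lemma xPart_append (t : Fin k → ℝ) (x : Fin d → ℝ) : xPart (Fin.append t x) = x :=
  funext fun l => Fin.append_right t x l

lemma append_tPart_xPart (p : Fin (k + d) → ℝ) : Fin.append (tPart p) (xPart p) = p :=
  Fin.append_castAdd_natAdd

/-- The components of a monomial map that is `C^1`-bounded in `x` are bounded, and bounded by a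
multiple of each of the variables that they contain. -/
lemma exists_monomial_bound {D : Set (Fin (k + d) → ℝ)} {h : (Fin (k + d) → ℝ) → ℝ}
    {b : (Fin (k + d) → ℝ) → (Fin N → ℝ)} (hb : IsPreparedInX F K D h b)
    (hb1 : IsCrBoundedInX 1 D b) (hopen : ∀ t, IsOpen (fiber D t))
    (hpos : ∀ p ∈ D, ∀ l, 0 < xPart p l) :
    ∃ (B Q : ℝ) (a : Fin N → (Fin k → ℝ) → ℝ) (μ : Fin N → Fin d → ℝ),
      1 ≤ B ∧ 0 ≤ Q ∧ (∀ i l, |μ i l| ≤ Q) ∧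
      (∀ i, ∀ p ∈ D, b p i = a i (tPart p) * ∏ l, xPart p l ^ μ i l) ∧
      (∀ i, ∀ p ∈ D, |b p i| ≤ B) ∧
      (∀ i, ∀ p ∈ D, ∀ l, μ i l ≠ 0 → |b p i| ≤ B * xPart p l) := by
  choose a μ _ hmon using hb.monomial
  obtain ⟨B0, hB0⟩ := hb1
  have hnorm : ∀ i, ∀ p ∈ D, ∀ ν : Fin d → ℕ, ∑ l, ν l ≤ 1 →
      |mpartial ν (fun y => fiberFun b (tPart p) y i) (xPart p)| ≤ B0 := by
    intro i p hp ν hν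
    have hx : xPart p ∈ fiber D (tPart p) := by
      change Fin.append (tPart p) (xPart p) ∈ D
      rwa [append_tPart_xPart]
    have h2 := (hB0 (tPart p) ⟨p, hp, rfl⟩).2
    have h3 : ENNReal.ofReal (|mpartial ν (fun y => fiberFun b (tPart p) y i) (xPart p)| /
        ((∑ i, ν i).factorial : ℝ)) ≤ B0 := by
      refine le_trans ?_ h2
      exact le_iSup_of_le i (le_iSup_of_le (xPart p) (le_iSup_of_le hx (le_iSup_of_le ν
        (le_iSup_of_le hν le_rfl))))
    rw [Nat.factorial_eq_one.2 hν, Nat.cast_one, div_one] at h3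
    have h4 := ENNReal.ofReal_le_iff_le_toReal (ENNReal.coe_ne_top) |>.1 h3
    simpa using h4
  have hval : ∀ i, ∀ p ∈ D, |b p i| ≤ B0 := by
    intro i p hp
    have := hnorm i p hp 0 (by simp)
    rw [mpartial_eq_of_sum_eq_zero (by simp)] at this
    simpa only [fiberFun, append_tPart_xPart] using this
  have hder : ∀ i, ∀ p ∈ D, ∀ l, |(μ i l : ℝ)| * |b p i| ≤ B0 * xPart p l := by
    intro i p hp l
    have h1 := hnorm i p hp (Pi.single l 1) (by simp)
    rw [mpartial_single] at h1
    have hx : xPart p ∈ fiber D (tPart p) := by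
      change Fin.append (tPart p) (xPart p) ∈ D
      rwa [append_tPart_xPart]
    have h2 := fderiv_monomial_single (a := a i (tPart p)) (μ := fun l => (μ i l : ℝ))
      (g := fun y => fiberFun b (tPart p) y i) (hpos p hp) (by
        filter_upwards [(hopen (tPart p)).mem_nhds hx] with y hy
        have := hmon i _ hy
        rwa [tPart_append, xPart_append] at this) l
    simp only [fiberFun, append_tPart_xPart] at h2
    rw [← abs_mul, ← h2, abs_mul, abs_of_pos (hpos p hp l), mul_comm]
    exact mul_le_mul_of_nonneg_right h1 (hpos p hp l).le
  have hfin : (Set.range fun q : Fin N × Fin d => max |(μ q.1 q.2 : ℝ)|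
      (B0 / |(μ q.1 q.2 : ℝ)|)).Finite := Set.finite_range _
  obtain ⟨Q, hQ⟩ := hfin.bddAbove
  have hQ' : ∀ i l, |(μ i l : ℝ)| ≤ Q ∧ B0 / |(μ i l : ℝ)| ≤ Q := fun i l =>
    max_le_iff.1 (hQ ⟨(i, l), rfl⟩)
  refine ⟨max 1 (max B0 Q), max 0 Q, a, fun i l => μ i l, le_max_left _ _, le_max_left _ _,
    fun i l => (hQ' i l).1.trans (le_max_right _ _), hmon,
    fun i p hp => (hval i p hp).trans ((le_max_left _ _).trans (le_max_right _ _)),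
    fun i p hp l hl => ?_⟩
  have hμ : 0 < |(μ i l : ℝ)| := abs_pos.2 hl
  have h1 : |b p i| ≤ B0 / |(μ i l : ℝ)| * xPart p l := by
    rw [div_mul_eq_mul_div, le_div_iff₀ hμ, mul_comm]
    exact hder i p hp l
  refine h1.trans (mul_le_mul_of_nonneg_right ?_ (hpos p hp l).le)
  exact (hQ' i l).2.trans ((le_max_right _ _).trans (le_max_right _ _))

/-- The preimage of the fiber `D_t` under `x ↦ x^R`, within the positive orthant. -/
def powFiber (R : Fin d → ℕ) (D : Set (Fin (k + d) → ℝ)) (t : Fin k → ℝ) : Set (Fin d → ℝ) :=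
  {x | (∀ l, 0 < x l) ∧ Fin.append t (fun l => x l ^ R l) ∈ D}

lemma isOpen_powFiber (R : Fin d → ℕ) {D : Set (Fin (k + d) → ℝ)} {t : Fin k → ℝ}
    (h : IsOpen (fiber D t)) : IsOpen (powFiber R D t) := by
  have h1 : IsOpen {x : Fin d → ℝ | ∀ l, 0 < x l} := by
    simp only [Set.ofPred_forall]
    exact isOpen_iInter_of_finite fun l => isOpen_lt continuous_const (continuous_apply l)
  have h2 : Continuous fun x : Fin d → ℝ => fun l => x l ^ R l :=
    continuous_pi fun l => (continuous_apply l).pow _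
  exact h1.inter (h.preimage h2)

lemma geomBound_powFiber_monomial {D : Set (Fin (k + d) → ℝ)} {a : (Fin k → ℝ) → ℝ}
    {μ : Fin d → ℝ} {β : (Fin (k + d) → ℝ) → ℝ} {B Q : ℝ} (hB : 1 ≤ B) (hQ : ∀ l, |μ l| ≤ Q)
    (hβ : ∀ p ∈ D, β p = a (tPart p) * ∏ l, xPart p l ^ μ l) (hβB : ∀ p ∈ D, |β p| ≤ B)
    (hβl : ∀ p ∈ D, ∀ l, μ l ≠ 0 → |β p| ≤ B * xPart p l)
    {q r : ℕ} (hq : 1 ≤ q) (hr : 1 ≤ r) {R : Fin d → ℕ} {S : ℝ} (hR : ∀ l, q * r ≤ R l)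
    (hRS : ∀ l, (R l : ℝ) ≤ S) {t : Fin k → ℝ} (hopen : IsOpen (fiber D t)) {a' : ℝ}
    (ha' : |a'| ≤ |a t| ^ (1 / q : ℝ)) :
    GeomBound B (d * ((Q + 1) * S)) r (powFiber R D t)
        (fun x => a' * ∏ l, x l ^ (μ l * R l / q)) ∧
      ∀ x ∈ powFiber R D t, |a'| * ∏ l, x l ^ (μ l * R l / q) ≤ B := by
  have habs : ∀ x ∈ powFiber R D t, |β (Fin.append t fun l => x l ^ R l)| =
      |a t| * ∏ l, (x l ^ R l) ^ μ l := fun x hx => by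
    rw [hβ _ hx.2, tPart_append, xPart_append, abs_mul, abs_of_nonneg (a := ∏ l, _)]
    exact Finset.prod_nonneg fun l _ => Real.rpow_nonneg (pow_nonneg (hx.1 l).le _) _
  have hv : ∀ x ∈ powFiber R D t, |a t| * ∏ l, (x l ^ R l) ^ μ l ≤ B := fun x hx => by
    rw [← habs x hx]
    exact hβB _ hx.2
  have hvl : ∀ x ∈ powFiber R D t, ∀ l, μ l ≠ 0 →
      |a t| * ∏ l, (x l ^ R l) ^ μ l ≤ B * x l ^ R l := fun x hx l hl => by
    rw [← habs x hx]
    have := hβl _ hx.2 l hl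
    rwa [xPart_append] at this
  refine ⟨geomBound_root_monomial hq hr hB hR hRS hQ ha' (isOpen_powFiber R hopen)
    (fun x hx => hx.1) hv hvl, fun x hx => ?_⟩
  simpa using root_monomial_div_le hq hr hB hR ha' hx.1 (hv x hx) (hvl x hx) (ν := 0)
    (by simp) (by simp)

lemma geomBound_powFiber_map {D : Set (Fin (k + d) → ℝ)} {b : (Fin (k + d) → ℝ) → (Fin N → ℝ)}
    {a : Fin N → (Fin k → ℝ) → ℝ} {μ : Fin N → Fin d → ℝ} {B Q : ℝ} (hB : 1 ≤ B) (hQ0 : 0 ≤ Q)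
    (hQ : ∀ i l, |μ i l| ≤ Q)
    (hb : ∀ i, ∀ p ∈ D, b p i = a i (tPart p) * ∏ l, xPart p l ^ μ i l)
    (hbB : ∀ i, ∀ p ∈ D, |b p i| ≤ B)
    (hbl : ∀ i, ∀ p ∈ D, ∀ l, μ i l ≠ 0 → |b p i| ≤ B * xPart p l)
    {r : ℕ} (hr : 1 ≤ r) {R : Fin d → ℕ} {S : ℝ} (hS : 0 ≤ S) (hR : ∀ l, r ≤ R l)
    (hRS : ∀ l, (R l : ℝ) ≤ S) {t : Fin k → ℝ} (hopen : IsOpen (fiber D t)) :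
    GeomBound B (d * ((Q + 1) * S)) r (powFiber R D t)
      (fun x => b (Fin.append t fun l => x l ^ R l)) := by
  refine GeomBound.pi (by linarith) (by positivity) (isOpen_powFiber R hopen).uniqueDiffOn
    fun i => ?_
  have h := (geomBound_powFiber_monomial (q := 1) hB (hQ i) (hb i) (hbB i) (hbl i) le_rfl hr
    (by simpa using hR) hRS hopen (a' := a i t) (by simp)).1
  refine h.congr fun x hx => ?_
  simp only
  rw [hb i _ hx.2, tPart_append, xPart_append]
  congr 1
  refine Finset.prod_congr rfl fun l _ => ?_
  rw [← Real.rpow_natCast, ← Real.rpow_mul (hx.1 l).le]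
  congr 1
  push_cast
  ring

lemma eventually_mild_powFiber {D : Set (Fin (k + d) → ℝ)} {h : (Fin (k + d) → ℝ) → ℝ}
    (hh : IsC1PreparedInX F K D h) (hopen : ∀ t, IsOpen (fiber D t))
    (hpos : ∀ p ∈ D, ∀ l, 0 < xPart p l) (h1 : ∀ p ∈ D, |h p| ≤ 1) :
    ∀ᶠ A in Filter.atTop, ∀ (r : ℕ) (R : Fin d → ℕ) (S : ℝ), 1 ≤ r → 0 ≤ S → (∀ l, r ≤ R l) →
      (∀ l, (R l : ℝ) ≤ S) → ∀ t, MildUpTo (S * A) 0 r (powFiber R D t)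
        (fun x => h (Fin.append t fun l => x l ^ R l)) := by
  obtain ⟨N, b, hb, hb1⟩ := hh
  obtain ⟨B, Q, a, μ, hB, hQ0, hQ, hmon, hbB, hbl⟩ := exists_monomial_bound hb hb1 hopen hpos
  obtain ⟨j, G, V, -, hV, hG, -, hfac⟩ := hb.factor
  have hZ : IsCompact (closure (b '' D)) := hb.bounded_map.isCompact_closure
  have hg : AnalyticOnNhd ℝ (fun z : Fin N → ℝ => z j * G z) (closure (b '' D)) := fun z hz =>
    ((ContinuousLinearMap.proj (R := ℝ) (φ := fun _ : Fin N => ℝ) j).analyticAt z).mul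
      (hG z (hV hz))
  obtain ⟨A0, hA0, hA⟩ := exists_norm_iteratedFDerivWithin_comp_le hZ hg
  filter_upwards [Filter.eventually_ge_atTop (A0 * B * (d * (Q + 1)))] with A hAA r R S hr hS hR
    hRS t
  have hU := isOpen_powFiber R (hopen t)
  have hbd := geomBound_powFiber_map hB hQ0 hQ hmon hbB hbl hr hS hR hRS (hopen t)
  obtain ⟨hc, hn⟩ := hA B _ r _ _ hB (by positivity) hU.uniqueDiffOn hbd
    (fun x hx => subset_closure ⟨_, hx.2, rfl⟩)
  have heq : Set.EqOn (fun x => h (Fin.append t fun l => x l ^ R l))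
      ((fun z : Fin N → ℝ => z j * G z) ∘ fun x => b (Fin.append t fun l => x l ^ R l))
      (powFiber R D t) := fun x hx => hfac _ hx.2
  refine mildUpTo_of_norm_le hU (fun x hx => h1 _ hx.2) (hc.congr heq) fun n hn1 hnr x hx => ?_
  rw [iteratedFDerivWithin_congr heq hx]
  refine (hn n hn1 hnr x hx).trans ?_
  refine mul_le_mul_of_nonneg_right (pow_le_pow_left₀ (by positivity) ?_ n) (by positivity)
  calc A0 * B * (d * ((Q + 1) * S)) = S * (A0 * B * (d * (Q + 1))) := by ring
    _ ≤ S * A := by gcongr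

lemma eventually_mild_root_powFiber {D : Set (Fin (k + d) → ℝ)} {h : (Fin (k + d) → ℝ) → ℝ}
    (hh : IsC1PreparedInX F K D h) (hopen : ∀ t, IsOpen (fiber D t))
    (hpos : ∀ p ∈ D, ∀ l, 0 < xPart p l) (h1 : ∀ p ∈ D, |h p| ≤ 1) :
    ∀ᶠ A in Filter.atTop, ∀ (q r : ℕ) (R : Fin d → ℕ) (S : ℝ), 1 ≤ q → 1 ≤ r → 0 ≤ S →
      (∀ l, q * r ≤ R l) → (∀ l, (R l : ℝ) ≤ S) → ∀ t, MildUpTo (S * A) 0 r (powFiber R D t)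
        (fun x => |h (Fin.append t fun l => x l ^ R l)| ^ (1 / q : ℝ)) := by
  obtain ⟨N, b, hb, hb1⟩ := hh
  obtain ⟨B, Q, a, μ, hB, hQ0, hQ, hmon, hbB, hbl⟩ := exists_monomial_bound hb hb1 hopen hpos
  obtain ⟨j, G, V, -, hV, hG, hG0, hfac⟩ := hb.factor
  let Z : Set (ℝ × ℝ × (Fin N → ℝ)) := Set.Icc 0 B ×ˢ Set.Icc 0 1 ×ˢ closure (b '' D)
  have hZ : IsCompact Z :=
    isCompact_Icc.prod (isCompact_Icc.prod hb.bounded_map.isCompact_closure)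
  let g : ℝ × ℝ × (Fin N → ℝ) → ℝ := fun z => z.1 * Real.exp (z.2.1 * (Real.log (G z.2.2 ^ 2) / 2))
  have hg : AnalyticOnNhd ℝ g Z := fun z hz => by
    have hGz : AnalyticAt ℝ (fun z : ℝ × ℝ × (Fin N → ℝ) => G z.2.2) z :=
      AnalyticAt.fun_comp (g := G) (f := fun z : ℝ × ℝ × (Fin N → ℝ) => z.2.2)
        (hG z.2.2 (hV hz.2.2))
        (AnalyticAt.fun_comp (g := Prod.snd) (f := Prod.snd) analyticAt_snd analyticAt_snd)
    have hlog : AnalyticAt ℝ (fun z : ℝ × ℝ × (Fin N → ℝ) => Real.log (G z.2.2 ^ 2)) z :=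
      AnalyticAt.fun_comp (g := Real.log) (f := fun z : ℝ × ℝ × (Fin N → ℝ) => G z.2.2 ^ 2)
        (analyticAt_log (sq_pos_of_ne_zero (hG0 z.2.2 (hV hz.2.2)))) (hGz.pow 2)
    exact analyticAt_fst.mul
      ((AnalyticAt.fun_comp (g := Prod.fst) (f := Prod.snd) analyticAt_fst analyticAt_snd).mul (hlog.div analyticAt_const two_ne_zero)).rexp
  obtain ⟨A0, hA0, hA⟩ := exists_norm_iteratedFDerivWithin_comp_le hZ hg
  filter_upwards [Filter.eventually_ge_atTop (A0 * B * (d * (Q + 1)))] with A hAA q r R S hq hr hS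
    hR hRS t
  have hq0 : (0 : ℝ) < q := by exact_mod_cast hq
  have hU := isOpen_powFiber R (hopen t)
  have hbd := geomBound_powFiber_map hB hQ0 hQ hmon hbB hbl hr hS
    (fun l => (Nat.le_mul_of_pos_left r hq).trans (hR l)) hRS (hopen t)
  have ha' : |(|a j t| ^ (1 / q : ℝ))| = |a j t| ^ (1 / q : ℝ) :=
    abs_of_nonneg (Real.rpow_nonneg (abs_nonneg _) _)
  obtain ⟨hw, hwB⟩ := geomBound_powFiber_monomial hB (hQ j) (hmon j) (hbB j) (hbl j) hq hr hR hRS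
    (hopen t) (a' := |a j t| ^ (1 / q : ℝ)) ha'.le
  rw [ha'] at hwB
  have hL0 : 0 ≤ d * ((Q + 1) * S) := by positivity
  obtain ⟨hc, hn⟩ := hA B _ r _ _ hB hL0 hU.uniqueDiffOn
    (hw.prodMk hU.uniqueDiffOn ((geomBound_const (by linarith) hL0 r _ (1 / q : ℝ)).prodMk
      hU.uniqueDiffOn hbd)) (fun x hx => by
        refine ⟨⟨?_, hwB x hx⟩, ⟨by positivity, ?_⟩, subset_closure ⟨_, hx.2, rfl⟩⟩
        · exact mul_nonneg (Real.rpow_nonneg (abs_nonneg _) _)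
            (Finset.prod_nonneg fun l _ => Real.rpow_nonneg (hx.1 l).le _)
        · rw [div_le_one hq0]
          exact_mod_cast hq)
  have heq : Set.EqOn (fun x => |h (Fin.append t fun l => x l ^ R l)| ^ (1 / q : ℝ))
      (g ∘ fun x => (|a j t| ^ (1 / q : ℝ) * ∏ l, x l ^ (μ j l * R l / q), (1 / q : ℝ),
        b (Fin.append t fun l => x l ^ R l))) (powFiber R D t) := fun x hx => by
    have hGx : G (b (Fin.append t fun l => x l ^ R l)) ≠ 0 :=
      hG0 _ (hV (subset_closure ⟨_, hx.2, rfl⟩))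
    simp only [g, Function.comp_apply]
    rw [hfac _ hx.2, abs_mul, Real.mul_rpow (abs_nonneg _) (abs_nonneg _), hmon j _ hx.2,
      tPart_append, xPart_append, abs_mul, Real.mul_rpow (abs_nonneg _) (abs_nonneg _)]
    congr 1
    · congr 1
      have hnn : ∀ l, 0 ≤ (x l ^ R l) ^ μ j l := fun l =>
        Real.rpow_nonneg (pow_nonneg (hx.1 l).le _) _
      rw [abs_of_nonneg (Finset.prod_nonneg fun l _ => hnn l),
        ← Real.finsetProd_rpow _ _ fun l _ => hnn l]
      refine Finset.prod_congr rfl fun l _ => ?_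
      rw [← Real.rpow_natCast, ← Real.rpow_mul (hx.1 l).le, ← Real.rpow_mul (hx.1 l).le]
      congr 1
      ring
    · rw [Real.rpow_def_of_pos (abs_pos.2 hGx), Real.log_abs, Real.log_pow]
      congr 1
      push_cast
      ring
  have hle1 : ∀ x ∈ powFiber R D t,
      |(|h (Fin.append t fun l => x l ^ R l)| ^ (1 / q : ℝ))| ≤ 1 := fun x hx => by
    rw [abs_of_nonneg (Real.rpow_nonneg (abs_nonneg _) _)]
    exact Real.rpow_le_one (abs_nonneg _) (h1 _ hx.2) (by positivity)
  refine mildUpTo_of_norm_le hU hle1 (hc.congr heq) fun n hn1 hnr x hx => ?_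
  rw [iteratedFDerivWithin_congr heq hx]
  refine (hn n hn1 hnr x hx).trans ?_
  refine mul_le_mul_of_nonneg_right (pow_le_pow_left₀ (by positivity) ?_ n) (by positivity)
  calc A0 * B * (d * ((Q + 1) * S)) = S * (A0 * B * (d * (Q + 1))) := by ring
    _ ≤ S * A := by gcongr

end Prepared

section Pullback

variable {F : (n : ℕ) → Set ((Fin n → ℝ) → ℝ)} {K : Subfield ℝ} {k m : ℕ}
  {c : (i : Fin (k + m)) → CoordCond (i : ℕ)}
  {α β : (i : Fin m) → (Fin (k + (i : ℕ)) → ℝ) → ℝ}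

lemma coordPow_append (r : ℕ) {i : ℕ} (t : Fin k → ℝ) (x : Fin i → ℝ) :
    coordPow (powExp k m r) (Fin.append t x) =
      Fin.append t (fun l : Fin i => x l ^ r ^ (m - (l : ℕ))) := by
  funext l
  refine Fin.addCases (fun l => ?_) (fun l => ?_) l
  · simp [coordPow, powExp]
  · simp [coordPow, powExp]

lemma fiber_cellSet_pullCond {T : Set (Fin k → ℝ)} {r : ℕ} (hr : 0 < r)
    (hc : ∀ i : Fin (k + m), (c i).Admissible F K (cellSet c (i : ℕ) i.2.le))
    (hw : ∀ i : Fin m, c (Fin.natAdd k i) = CoordCond.between (α i) (β i))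
    (hCT : cellSet c (k + m) le_rfl ⊆ cubeOver T m) {i : ℕ} (hi : i ≤ m) (t : Fin k → ℝ) :
    fiber (cellSet (pullCond r c α β) (k + i) (Nat.add_le_add_left hi k)) t =
      powFiber (fun l : Fin i => r ^ (m - (l : ℕ)))
        (cellSet c (k + i) (Nat.add_le_add_left hi k)) t := by
  ext x
  refine (mem_cellSet_pullCond hr hc hw hCT _ _).trans ?_
  rw [coordPow_append]
  refine and_congr_left fun _ => ⟨fun h l => ?_, fun h l => ?_⟩
  · simpa using h (Fin.natAdd k l) (by simp)
  · refine Fin.addCases (fun l hl => ?_) (fun l _ => ?_) l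
    · simp only [Fin.val_castAdd] at hl
      exact absurd l.2 (by lia)
    · simpa using h l

end Pullback

end MildCell

open MildCell in
theorem mainTheorem3
    (F : (n : ℕ) → Set ((Fin n → ℝ) → ℝ))
    (hF : ∀ n, ∀ g ∈ F n, AnalyticOnNhd ℝ g {x | ∀ i, x i ∈ Set.Icc (-1 : ℝ) 1})
    (K : Subfield ℝ) {k m : ℕ}
    (T : Set (Fin k → ℝ)) (hT : IsDefinable F K T)
    (C : Set (Fin (k + m) → ℝ)) (hCT : C ⊆ cubeOver T m)
    (α β : (i : Fin m) → (Fin (k + (i : ℕ)) → ℝ) → ℝ)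
    (hC : IsCellWithWalls F K C α β)
    (hα : ∀ i, IsC1PreparedInX F K (projLt i C) (α i))
    (hβ : ∀ i, IsC1PreparedInX F K (projLt i C) (β i))
    (f : (Fin (k + m) → ℝ) → ℝ) (hf1 : ∀ p ∈ C, f p ∈ Set.Icc (-1 : ℝ) 1)
    (hf : IsC1PreparedInX F K C f) :
    ∃ A : ℝ, 0 < A ∧ ∀ r : ℕ, 0 < r →
      ∃ αr βr : (i : Fin m) → (Fin (k + (i : ℕ)) → ℝ) → ℝ,
        IsCellWithWalls F K (pullback T r C) αr βr ∧
        ∀ t ∈ T,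
          (∀ i : Fin m, (i : ℕ) = 0 →
            Mild A 0 (fiber (projLt i (pullback T r C)) t) (fiberFun (αr i) t) ∧
            Mild A 0 (fiber (projLt i (pullback T r C)) t) (fiberFun (βr i) t)) ∧
          (∀ i : Fin m, 1 ≤ (i : ℕ) →
            MildUpTo ((r : ℝ) ^ m * A) 0 r
              (fiber (projLt i (pullback T r C)) t) (fiberFun (αr i) t) ∧
            MildUpTo ((r : ℝ) ^ m * A) 0 r
              (fiber (projLt i (pullback T r C)) t) (fiberFun (βr i) t)) ∧
          MildUpTo ((r : ℝ) ^ m * A) 0 r (fiber (pullback T r C) t)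
            (fiberFun (f ∘ powSub r) t) := by
  obtain ⟨c, ⟨hc, rfl⟩, hw⟩ := hC
  have hproj : ∀ i : Fin m, projLt i (cellSet c (k + m) le_rfl) =
      cellSet c (k + i) (Nat.add_le_add_left i.2.le k) := fun i => image_take_cellSet hc _
  have hopen : ∀ {i : ℕ} (hi : i ≤ m) (t : Fin k → ℝ),
      IsOpen (fiber (cellSet c (k + i) (Nat.add_le_add_left hi k)) t) := fun hi t =>
    isOpen_fiber_cellSet hc hw t hi
  have hpos : ∀ {i : ℕ} (hi : i ≤ m), ∀ p ∈ cellSet c (k + i) (Nat.add_le_add_left hi k),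
      ∀ l : Fin i, 0 < xPart p l := fun hi p hp l =>
    (coord_mem_Ioo_of_mem_cellSet hc hCT _ hp (Fin.natAdd k l) (by simp)).1
  have hα1 : ∀ i : Fin m, ∀ p ∈ cellSet c (k + i) (Nat.add_le_add_left i.2.le k),
      |α i p| ≤ 1 := fun i p hp => by
    obtain ⟨h0, h1, h2⟩ := walls_mem_Icc hc hw hCT i hp
    rw [abs_of_nonneg h0]
    exact h1.le.trans h2
  have hβ1 : ∀ i : Fin m, ∀ p ∈ cellSet c (k + i) (Nat.add_le_add_left i.2.le k),
      |β i p| ≤ 1 := fun i p hp => by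
    obtain ⟨h0, h1, h2⟩ := walls_mem_Icc hc hw hCT i hp
    rwa [abs_of_nonneg (h0.trans h1.le)]
  have eα := Filter.eventually_all.2 fun i : Fin m =>
    eventually_mild_root_powFiber (hproj i ▸ hα i) (hopen i.2.le) (hpos i.2.le) (hα1 i)
  have eβ := Filter.eventually_all.2 fun i : Fin m =>
    eventually_mild_root_powFiber (hproj i ▸ hβ i) (hopen i.2.le) (hpos i.2.le) (hβ1 i)
  have ef := eventually_mild_powFiber hf (hopen le_rfl) (hpos le_rfl)
    fun p hp => abs_le.2 (hf1 p hp)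
  obtain ⟨A, hA0, hAα, hAβ, hAf⟩ :=
    ((Filter.eventually_gt_atTop (0 : ℝ)).and (eα.and (eβ.and ef))).exists
  refine ⟨A, hA0, fun r hr => ⟨fun i => rootWall k m r i (α i), fun i => rootWall k m r i (β i),
    ?_, fun t _ => ?_⟩⟩
  · exact ⟨pullCond r c α β, ⟨admissible_pullCond hr hc hw hCT,
      pullback_eq_cellSet hr hc hw hCT⟩, fun i =>
      Fin.addCases_right (motive := fun i => CoordCond (i : ℕ)) i⟩
  have hfib : ∀ i : Fin m, fiber (projLt i (pullback T r (cellSet c (k + m) le_rfl))) t =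
      powFiber (fun l : Fin i => r ^ (m - (l : ℕ)))
        (cellSet c (k + i) (Nat.add_le_add_left i.2.le k)) t := fun i => by
    rw [pullback_eq_cellSet hr hc hw hCT, ← fiber_cellSet_pullCond hr hc hw hCT i.2.le]
    congr 1
    exact image_take_cellSet (admissible_pullCond hr hc hw hCT) _
  have hwall : ∀ (i : Fin m) (γ : (Fin (k + (i : ℕ)) → ℝ) → ℝ),
      fiberFun (rootWall k m r i γ) t = fun x : Fin i → ℝ =>
        |γ (Fin.append t fun l => x l ^ r ^ (m - (l : ℕ)))| ^ (1 / (r ^ (m - i) : ℕ) : ℝ) :=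
    fun i γ => by
      funext x
      simp only [fiberFun, rootWall, coordPow_append]
  have hRS : ∀ l : ℕ, ((r ^ (m - l) : ℕ) : ℝ) ≤ (r : ℝ) ^ m := fun l => by
    exact_mod_cast Nat.pow_le_pow_right hr (Nat.sub_le m l)
  refine ⟨fun i hi => ?_, fun i _ => ?_, ?_⟩
  · have habs : ∀ (γ : (Fin (k + (i : ℕ)) → ℝ) → ℝ),
        (∀ p ∈ cellSet c (k + i) (Nat.add_le_add_left i.2.le k), |γ p| ≤ 1) →
        Mild A 0 (fiber (projLt i (pullback T r (cellSet c (k + m) le_rfl))) t)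
          (fiberFun (rootWall k m r i γ) t) := fun γ hγ => by
      refine mild_of_dim_eq_zero hi A fun x hx => ?_
      rw [hfib] at hx
      rw [hwall, abs_of_nonneg (Real.rpow_nonneg (abs_nonneg _) _)]
      exact Real.rpow_le_one (abs_nonneg _) (hγ _ hx.2) (by positivity)
    exact ⟨habs _ (hα1 i), habs _ (hβ1 i)⟩
  · have hR : ∀ l : Fin i, r ^ (m - (i : ℕ)) * r ≤ r ^ (m - (l : ℕ)) := fun l => by
      rw [← pow_succ]
      exact Nat.pow_le_pow_right hr (by lia)
    rw [hfib, hwall, hwall]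
    exact ⟨hAα i _ r _ _ (Nat.pow_pos hr) hr (by positivity) hR (fun l => hRS l) t,
      hAβ i _ r _ _ (Nat.pow_pos hr) hr (by positivity) hR (fun l => hRS l) t⟩
  · have hfun : fiberFun (f ∘ powSub r) t = fun x : Fin m → ℝ =>
        f (Fin.append t fun l => x l ^ r ^ (m - (l : ℕ))) := by
      funext x
      simp only [fiberFun, Function.comp_apply, powSub_eq_coordPow, coordPow_append]
    rw [pullback_eq_cellSet hr hc hw hCT, hfun]
    have := fiber_cellSet_pullCond hr hc hw hCT (le_refl m) t
    rw [this]
    exact hAf r _ _ hr (by positivity)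
      (fun l => Nat.le_self_pow (by lia) r) (fun l => hRS l) t
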